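/- Let $X_1,X_2,\ldots$ be i.i.d. real random variables that are not almost surely constant, and let $S_n=S_0+X_1+\dots+X_n$, $n\ge 0$, be the corresponding random walk; $\mathbb P_x$ denotes the probability under which $S_0=x$, and $\mathbb P_\nu=\int \mathbb P_x(\cdot)\,\nu(dx)$ for a measure $\nu$. Let $\mathcal Z$ be the smallest closed subgroup of $(\mathbb R,+)$ that contains the topological support of the distribution of $X_1$, and let $\lambda$ be a Haar measure on $\mathcal Z$ (with any normalization). Assume that $S$ is topologically recurrent, i.e. $\mathbb P_0(S_n\in G \text{ for infinitely many } n)=1$ for every open neighbourhood $G$ of $0$. Put $\mathcal T_0=0$ and, for $n\ge1$, $\mathcal T_n=\inf\{k>\mathcal T_{n-1}: S_{k-1}<0\le S_k \text{ or } S_k<0\le S_{k-1}\}$, where $\inf\varnothing=\infty$. For $n\ge 1$ let $\mathcal O_n=S_{\mathcal T_n}$ (where $S_\infty=\dagger$ is an additional cemetery state), $O_n=\mathcal O_{2n-\mathbb 1(S_0<0)}$ and $O^\downarrow_n=\mathcal O_{2n-\mathbb 1(S_0\ge0)}$: these are the chains of all overshoots, of overshoots at up-crossings, and of overshoots at down-crossings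 of the zero level. They are regarded as Markov chains on $\mathcal Z$, $\mathcal Z\cap[0,\infty)$ and $\mathcal Z\cap(-\infty,0)$ respectively (with $\dagger$ added), started at $\mathcal O_0=O_0=O^\downarrow_0=S_0$. Consider the measures $$\pi_+(dx)=\bigl(1-\mathbb P(X_1\le x)\bigr)\lambda(dx)\ \text{ on } \mathcal Z\cap[0,\infty),\qquad \pi_-(dx)=\bigl(1-\mathbb P(X_1>x)\bigr)\lambda(dx)\ \text{ on } \mathcal Z\cap(-\infty,0),$$ $$\pi(dx)=\bigl[\mathbb 1_{[0,\infty)}(x)\,\mathbb P(X_1>x)+\mathbb 1_{(-\infty,0)}(x)\,\mathbb P(X_1\le x)\bigr]\lambda(dx)\ \text{ on } \mathcal Z .$$ For a chain $Y$ on $E_\dagger=E\cup\{\dagger\}$, a Borel measure $\nu$ on $E$ is invariant if $\int_E\mathbb P_x(Y_1\in B)\,\nu(dx)=\nu(B)$ for all Borel $B\subseteq E$. An invariant measure $\nu$ is recurrent if for every Borel $B\subseteq E$ with $\nu(B)<\infty$, $\mathbb P_x(Y_n\in B\text{ for some }n\ge1)=1$ for $\nu$-a.e. $x\in B$; it is ergodic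 if the shift on the space $E_\dagger^{\{0,1,2,\dots\}}$ of trajectories preserves the measure $\mathbb P_\nu(Y\in\cdot)$ and is ergodic for it; it is uniquely invariant if it is non-zero and locally finite on $E$ and every locally finite invariant Borel measure on $E$ is of the form $c\nu$ with a constant $c\in[0,\infty)$. Then $\pi_+$ is recurrent, ergodic and uniquely invariant for $O$ on $\mathcal Z\cap[0,\infty)$; $\pi_-$ is recurrent, ergodic and uniquely invariant for $O^\downarrow$ on $\mathcal Z\cap(-\infty,0)$; and $\pi$ is recurrent, ergodic and uniquely invariant for $\mathcal O$ on $\mathcal Z$. -/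

import Mathlib

open MeasureTheory ProbabilityTheory Filter Topology
open scoped ENNReal NNReal

noncomputable section

/-! ### Markov chains with a cemetery state, given by their path laws -/

namespace MarkovChain

variable {X : Type*} [MeasurableSpace X]

/-- The space of trajectories `(Y₀, Y₁, …)` of a chain on `X`, with a cemetery state `†`
added to `X`: `Sum.inl x` is the state `x`, and `Sum.inr ()` is the cemetery. -/
abbrev Traj (X : Type*) : Type _ := ℕ → X ⊕ Unit

/-- The one-sided shift. -/
def shift (w : Traj X) : Traj X := fun n => w (n + 1)

/-- The event that the chain is in `B ⊆ X` at time `n`. -/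
def atTime (n : ℕ) (B : Set X) : Set (Traj X) := {w | w n ∈ Sum.inl '' B}

/- Below `Q x` is the law of the trajectory `(Y₀, Y₁, …)` of a time-homogeneous Markov chain
started at `Y₀ = x`. A measure on a measurable subset `E` of `X` is identified with a measure on
`X` that vanishes outside `E`. -/

/-- The measure `ν` on `E` is invariant for the chain:
`∫_E P_x(Y₁ ∈ B) ν(dx) = ν(B)` for every measurable `B ⊆ E`. -/
def IsInvariant (Q : Kernel X (Traj X)) (E : Set X) (ν : Measure X) : Prop :=
  ν Eᶜ = 0 ∧ ∀ B : Set X, MeasurableSet B → B ⊆ E → ∫⁻ x, Q x (atTime 1 B) ∂ν = ν B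

/-- The invariant measure `ν` on `E` is recurrent: for every measurable `B ⊆ E` of finite measure,
the chain started at `ν`-a.e. point of `B` returns to `B` a.s. -/
def IsRecurrent (Q : Kernel X (Traj X)) (E : Set X) (ν : Measure X) : Prop :=
  IsInvariant Q E ν ∧
    ∀ B : Set X, MeasurableSet B → B ⊆ E → ν B < ∞ →
      ∀ᵐ x ∂ν, x ∈ B → Q x (⋃ n : ℕ, atTime (n + 1) B) = 1

/-- The invariant measure `ν` on `E` is ergodic: the shift preserves the law
`∫ Q x (·) ν(dx)` of the chain started under `ν`, and it is ergodic for this law. -/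
def IsErgodic (Q : Kernel X (Traj X)) (E : Set X) (ν : Measure X) : Prop :=
  IsInvariant Q E ν ∧ Ergodic shift (ν.bind Q)

/-- Local finiteness on `E` (in the relative topology of `E`) of a measure that is carried
by `E`. -/
def LocallyFiniteOn [TopologicalSpace X] (E : Set X) (ν : Measure X) : Prop :=
  ∀ x ∈ E, ν.FiniteAtFilter (𝓝[E] x)

/-- `ν` is a non-zero locally finite invariant measure on `E`, and it is the only one up to
multiplication by constants. -/
def IsUniquelyInvariant [TopologicalSpace X] (Q : Kernel X (Traj X)) (E : Set X)
    (ν : Measure X) : Prop :=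
  ν ≠ 0 ∧ IsInvariant Q E ν ∧ LocallyFiniteOn E ν ∧
    ∀ ν' : Measure X, IsInvariant Q E ν' → LocallyFiniteOn E ν' → ∃ c : ℝ≥0, ν' = c • ν

end MarkovChain

/-! ### One-dimensional random walks and their overshoots of the zero level -/

namespace RandomWalk

/-- The trajectory of the walk with starting point `x` and increments `ξ 0, ξ 1, …`. -/
def walkPath (x : ℝ) (ξ : ℕ → ℝ) : ℕ → ℝ := fun n => x + ∑ i ∈ Finset.range n, ξ i

lemma measurable_walkPath : Measurable fun p : ℝ × (ℕ → ℝ) => walkPath p.1 p.2 := by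
  unfold walkPath
  fun_prop

/-- `walkLaw μ x` is the law of the trajectory of the random walk that starts at `x` and has
i.i.d. increments with distribution `μ`. -/
def walkLaw (μ : Measure ℝ) [IsProbabilityMeasure μ] : Kernel ℝ (ℕ → ℝ) where
  toFun x := (Measure.infinitePi fun _ : ℕ => μ).map (walkPath x)
  measurable' := by
    have h : (fun x : ℝ => (Measure.infinitePi fun _ : ℕ => μ).map (walkPath x)) =
        fun x => ((Kernel.id ×ₖ Kernel.const ℝ (Measure.infinitePi fun _ : ℕ => μ)).map
          fun p : ℝ × (ℕ → ℝ) => walkPath p.1 p.2) x := by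
      funext x
      rw [Kernel.map_apply _ measurable_walkPath, Kernel.prod_apply, Kernel.id_apply,
        Kernel.const_apply, Measure.dirac_prod,
        Measure.map_map measurable_walkPath (by fun_prop)]
      rfl
    rw [h]
    exact Kernel.measurable _

/-- The walk visits every neighbourhood of its starting point `0` infinitely often a.s. -/
def TopologicallyRecurrent (μ : Measure ℝ) [IsProbabilityMeasure μ] : Prop :=
  ∀ G : Set ℝ, IsOpen G → 0 ∈ G → walkLaw μ 0 {s | ∃ᶠ n in atTop, s n ∈ G} = 1

/-- The state space of the walk: the minimal closed subgroup of `ℝ` that contains the topological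
support of the distribution of the increments. -/
def stateSpace (μ : Measure ℝ) : AddSubgroup ℝ :=
  (AddSubgroup.closure μ.support).topologicalClosure

/-- The trajectory `s` crosses the zero level (upwards or downwards) at time `k`. -/
def IsCrossing (s : ℕ → ℝ) (k : ℕ) : Prop :=
  1 ≤ k ∧ ((s (k - 1) < 0 ∧ 0 ≤ s k) ∨ (0 ≤ s (k - 1) ∧ s k < 0))

/-- The `n`-th crossing time of the zero level; it is `∞` if there are fewer than `n`
crossings, and the one with index `0` is `0`. -/
def crossingTime (s : ℕ → ℝ) : ℕ → ℕ∞
  | 0 => 0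
  | n + 1 => ⨅ k : ℕ, ⨅ _ : crossingTime s n < k ∧ IsCrossing s k, (k : ℕ∞)

/-- The value of the trajectory `s` at time `t`; it is the cemetery when `t = ∞`. -/
def valueAt (s : ℕ → ℝ) (t : ℕ∞) : ℝ ⊕ Unit :=
  if t = ⊤ then Sum.inr () else Sum.inl (s t.toNat)

/-- The overshoots at all crossings of zero, preceded by the starting point `s 0`. -/
def overshoot (s : ℕ → ℝ) : MarkovChain.Traj ℝ := fun n => valueAt s (crossingTime s n)

open Classical in
/-- The overshoots at up-crossings, `O_n = 𝒪_{2n - 1(S₀ < 0)}` for `n ≥ 1`, preceded by the starting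
point `s 0` (the index is `0` for `n = 0` since the subtraction is truncated). -/
def upOvershoot (s : ℕ → ℝ) : MarkovChain.Traj ℝ :=
  fun n => overshoot s (2 * n - if s 0 < 0 then 1 else 0)

open Classical in
/-- The overshoots at down-crossings, `O↓_n = 𝒪_{2n - 1(S₀ ≥ 0)}` for `n ≥ 1`, preceded by the
starting point `s 0` (the index is `0` for `n = 0` since the subtraction is truncated). -/
def downOvershoot (s : ℕ → ℝ) : MarkovChain.Traj ℝ :=
  fun n => overshoot s (2 * n - if 0 ≤ s 0 then 1 else 0)

lemma measurableSet_isCrossing (k : ℕ) : MeasurableSet {s : ℕ → ℝ | IsCrossing s k} := by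
  unfold IsCrossing
  measurability

lemma measurable_crossingTime (n : ℕ) : Measurable fun s : ℕ → ℝ => crossingTime s n := by
  classical
  haveI : BorelSpace ℕ∞ := ⟨borel_eq_top_of_countable.symm⟩
  induction n with
  | zero => exact measurable_const
  | succ n ih =>
    simp only [crossingTime, iInf_eq_if]
    refine Measurable.iInf fun k => Measurable.ite ?_ measurable_const measurable_const
    exact (measurableSet_lt ih measurable_const).inter (measurableSet_isCrossing k)

lemma measurable_overshoot : Measurable overshoot := by
  refine measurable_pi_iff.2 fun n => ?_
  have h : Measurable fun p : (ℕ → ℝ) × ℕ∞ => valueAt p.1 p.2 := by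
    refine measurable_from_prod_countable_left fun t => ?_
    unfold valueAt
    by_cases ht : t = ⊤
    · simp only [ht, if_true]; exact measurable_const
    · simp only [ht, if_false]; exact measurable_inl.comp (measurable_pi_apply _)
  exact h.comp (measurable_id.prodMk (measurable_crossingTime n))

lemma measurable_upOvershoot : Measurable upOvershoot := by
  classical
  refine measurable_pi_iff.2 fun n => ?_
  have h (m : ℕ) : Measurable fun s => overshoot s m :=
    (measurable_pi_apply m).comp measurable_overshoot
  have : (fun s => upOvershoot s n) =
      fun s => if s 0 < 0 then overshoot s (2 * n - 1) else overshoot s (2 * n - 0) := by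
    funext s; unfold upOvershoot; split_ifs <;> rfl
  rw [this]
  exact Measurable.ite (measurableSet_lt (measurable_pi_apply 0) measurable_const) (h _) (h _)

lemma measurable_downOvershoot : Measurable downOvershoot := by
  classical
  refine measurable_pi_iff.2 fun n => ?_
  have h (m : ℕ) : Measurable fun s => overshoot s m :=
    (measurable_pi_apply m).comp measurable_overshoot
  have : (fun s => downOvershoot s n) =
      fun s => if 0 ≤ s 0 then overshoot s (2 * n - 1) else overshoot s (2 * n - 0) := by
    funext s; unfold downOvershoot; split_ifs <;> rfl
  rw [this]
  exact Measurable.ite (measurableSet_le measurable_const (measurable_pi_apply 0)) (h _) (h _)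

/-- The law of a measurable functional of the walk, as a function of the starting point. -/
def chainLaw (μ : Measure ℝ) [IsProbabilityMeasure μ] (F : (ℕ → ℝ) → MarkovChain.Traj ℝ)
    (hF : Measurable F) : Kernel ℝ (MarkovChain.Traj ℝ) where
  toFun x := (walkLaw μ x).map F
  measurable' := (Measure.measurable_map F hF).comp (walkLaw μ).measurable

/-- The chain `𝒪` of all overshoots. -/
def overshootChain (μ : Measure ℝ) [IsProbabilityMeasure μ] : Kernel ℝ (MarkovChain.Traj ℝ) :=
  chainLaw μ overshoot measurable_overshoot

/-- The chain `O` of overshoots at up-crossings. -/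
def upOvershootChain (μ : Measure ℝ) [IsProbabilityMeasure μ] : Kernel ℝ (MarkovChain.Traj ℝ) :=
  chainLaw μ upOvershoot measurable_upOvershoot

/-- The chain `O↓` of overshoots at down-crossings. -/
def downOvershootChain (μ : Measure ℝ) [IsProbabilityMeasure μ] :
    Kernel ℝ (MarkovChain.Traj ℝ) :=
  chainLaw μ downOvershoot measurable_downOvershoot

/-- A measure on the state space of the walk, regarded as a measure on `ℝ`. -/
def onReal {μ : Measure ℝ} (lam : Measure (stateSpace μ)) : Measure ℝ :=
  lam.map Subtype.val

/-- `π₊(dx) = (1 - P(X₁ ≤ x)) λ(dx)` on `𝒵 ∩ [0, ∞)`. -/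
def piPlus (μ : Measure ℝ) (lam : Measure (stateSpace μ)) : Measure ℝ :=
  ((onReal lam).restrict (Set.Ici 0)).withDensity fun x => 1 - μ (Set.Iic x)

/-- `π₋(dx) = (1 - P(X₁ > x)) λ(dx)` on `𝒵 ∩ (-∞, 0)`. -/
def piMinus (μ : Measure ℝ) (lam : Measure (stateSpace μ)) : Measure ℝ :=
  ((onReal lam).restrict (Set.Iio 0)).withDensity fun x => 1 - μ (Set.Ioi x)

/-- `π(dx) = [1_{[0,∞)}(x) P(X₁ > x) + 1_{(-∞,0)}(x) P(X₁ ≤ x)] λ(dx)` on `𝒵`. -/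
def piFull (μ : Measure ℝ) (lam : Measure (stateSpace μ)) : Measure ℝ :=
  (onReal lam).withDensity fun x =>
    (Set.Ici (0 : ℝ)).indicator (fun y => μ (Set.Ioi y)) x +
      (Set.Iio (0 : ℝ)).indicator (fun y => μ (Set.Iic y)) x

end RandomWalk

end

/-! Let `P` be the transition operator of the walk, and for a set `C` of pairs split `P = P_C +
P_{Cᶜ}` according to whether the jump from `x` to `x + X₁` lies in `C` (`jumpOp` on functions,
`jump` on measures). With `C` the up-crossings, the down-crossings, or both, each of the three
chains lists the positions right after the successive jumps in `C`, so one argument serves all three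
(`ListsJumps`). If `m(ν) = ∑ₖ ν P_{Cᶜ}ᵏ` is the occupation measure before the first jump in `C`, one
step of the chain turns `ν` into `m(ν) P_C`. The candidate invariant measure is `λ P_C`; reversing a
step of the walk under `λ` shows that its density is that of `π₊`, `π₋` or `π`.

Everything rests on a rigidity property, `eq_smul_onReal_of_excessive`: a locally finite excessive
measure `m` of a topologically recurrent walk is a multiple of `λ`. For open `U` the function `y ↦
m(U - y)` is superharmonic and lower semicontinuous. The walk visits every open set that meets `𝒵`,
so such a function is constant on `𝒵`, and `m` is translation invariant. By duality, bounded
excessive functions are constant `λ`-a.e.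

Invariance: `m = m(λ P_C)` is at most `λ` and excessive, hence a multiple of `λ`, and so `m = m P`.
Comparing this with `m = λ P_C + m P_{Cᶜ}` gives `m P_C = λ P_C`. Uniqueness: if `ν` is invariant
for the chain, then `m(ν)` is invariant for the walk. Once it is locally finite it equals `c λ`, and
`ν = m(ν) P_C = c λ P_C`. Local finiteness holds because from some open set the walk jumps through
`C` into a fixed compact set with probability bounded below (`HasUniformJump`). Ergodicity: a
shift-invariant event of the chain pulls back to a shift-invariant event of the walk; its
probability is a.e. constant, which makes it independent of itself. Recurrence: infinitely many
jumps in `C` that land in `B` occur with probability `0` or `1`, and `0` is impossible when `λ P_C`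
charges `B`. -/

namespace RandomWalk

/-! ### Path space and the Markov property -/

/-- The path `x, s 0, s 1, …`. -/
def prepend (x : ℝ) (s : ℕ → ℝ) : ℕ → ℝ
  | 0 => x
  | n + 1 => s n

/-- The one-sided shift on the paths of the walk. -/
def tail (s : ℕ → ℝ) : ℕ → ℝ := fun n => s (n + 1)

@[simp] lemma prepend_zero (x : ℝ) (s : ℕ → ℝ) : prepend x s 0 = x := rfl

@[simp] lemma prepend_succ (x : ℝ) (s : ℕ → ℝ) (n : ℕ) : prepend x s (n + 1) = s n := rfl

@[simp] lemma tail_prepend (x : ℝ) (s : ℕ → ℝ) : tail (prepend x s) = s := rfl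

lemma tail_apply (s : ℕ → ℝ) (n : ℕ) : tail s n = s (n + 1) := rfl

lemma measurable_tail : Measurable tail := by
  unfold tail
  fun_prop

lemma measurable_prepend : Measurable fun p : ℝ × (ℕ → ℝ) => prepend p.1 p.2 := by
  refine measurable_pi_iff.2 fun n => ?_
  cases n with
  | zero => exact measurable_fst
  | succ n => exact (measurable_pi_apply n).comp measurable_snd

lemma measurable_prepend_right (x : ℝ) : Measurable (prepend x) :=
  measurable_prepend.comp (measurable_const.prodMk measurable_id)

lemma walkPath_prepend (x z : ℝ) (ξ : ℕ → ℝ) :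
    walkPath x (prepend z ξ) = prepend x (walkPath (x + z) ξ) := by
  funext n
  cases n with
  | zero => simp [walkPath]
  | succ n => simp [walkPath, Finset.sum_range_succ']; ring

lemma measurable_walkPath_right (x : ℝ) : Measurable (walkPath x) :=
  measurable_walkPath.comp (measurable_const.prodMk measurable_id)

section

variable (μ : Measure ℝ) [IsProbabilityMeasure μ]

/-- The source of the Markov property: an independent first increment put before an i.i.d. sequence
gives an i.i.d. sequence. It suffices to compare cylinders, and these are padded with `univ` to
constrain exactly the coordinates `0, …, n`. -/
lemma map_prepend_prod_infinitePi :
    (μ.prod (Measure.infinitePi fun _ : ℕ => μ)).map (fun p => prepend p.1 p.2) =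
      Measure.infinitePi fun _ : ℕ => μ := by
  classical
  refine Measure.eq_infinitePi _ fun s t ht => ?_
  obtain ⟨n, hn⟩ : ∃ n, s ⊆ Finset.range (n + 1) := by
    obtain ⟨n, hn⟩ := s.exists_nat_subset_range
    exact ⟨n, hn.trans (Finset.range_mono (Nat.le_succ n))⟩
  set t' : ℕ → Set ℝ := fun i => if i ∈ s then t i else Set.univ with ht'
  have mt' (i : ℕ) : MeasurableSet (t' i) := by
    simp only [ht']; split_ifs
    exacts [ht i, MeasurableSet.univ]
  have hprod : ∏ i ∈ s, μ (t i) = ∏ i ∈ Finset.range (n + 1), μ (t' i) := by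
    rw [← Finset.prod_subset hn (f := fun i => μ (t' i))]
    · exact Finset.prod_congr rfl fun i hi => by simp [ht', hi]
    · intro i _ hi
      simp [ht', hi]
  have hset : (fun p : ℝ × (ℕ → ℝ) => prepend p.1 p.2) ⁻¹' Set.pi (s : Set ℕ) t =
      t' 0 ×ˢ Set.pi (Finset.range n : Set ℕ) fun i => t' (i + 1) := by
    ext ⟨x, ξ⟩
    simp only [Set.mem_preimage, Set.mem_pi, Finset.mem_coe, Set.mem_prod, Finset.mem_range]
    constructor
    · intro h
      constructor
      · simp only [ht']; split_ifs with h0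
        exacts [h 0 h0, trivial]
      · intro i _
        simp only [ht']; split_ifs with h0
        exacts [h _ h0, trivial]
    · rintro ⟨h0, h1⟩ i hi
      cases i with
      | zero => simpa [ht', hi] using h0
      | succ i =>
        have := h1 i (by have := Finset.mem_range.1 (hn hi); omega)
        simpa [ht', hi] using this
  rw [Measure.map_apply measurable_prepend (MeasurableSet.pi s.countable_toSet fun i _ => ht i),
    hset, Measure.prod_prod, Measure.infinitePi_pi _ (fun i _ => mt' _), hprod,
    Finset.prod_range_succ', mul_comm]

lemma walkLaw_apply (x : ℝ) :
    walkLaw μ x = (Measure.infinitePi fun _ : ℕ => μ).map (walkPath x) := rfl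

instance : IsMarkovKernel (walkLaw μ) :=
  ⟨fun x => by
    rw [walkLaw_apply]
    exact Measure.isProbabilityMeasure_map (measurable_walkPath_right x).aemeasurable⟩

variable {μ}

/-- The Markov property at time `1`. -/
lemma lintegral_walkLaw {f : (ℕ → ℝ) → ℝ≥0∞} (hf : Measurable f) (x : ℝ) :
    ∫⁻ s, f s ∂walkLaw μ x = ∫⁻ z, ∫⁻ s, f (prepend x s) ∂walkLaw μ (x + z) ∂μ := by
  have hm : Measurable fun p : ℝ × (ℕ → ℝ) => f (walkPath x (prepend p.1 p.2)) :=
    hf.comp ((measurable_walkPath_right x).comp measurable_prepend)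
  rw [walkLaw_apply, lintegral_map hf (measurable_walkPath_right x)]
  conv_lhs => rw [← map_prepend_prod_infinitePi μ]
  rw [lintegral_map (f := fun a => f (walkPath x a))
      (hf.comp (measurable_walkPath_right x)) measurable_prepend,
    lintegral_prod _ hm.aemeasurable]
  refine lintegral_congr fun z => ?_
  rw [walkLaw_apply, lintegral_map (f := fun a => f (prepend x a))
    (hf.comp (measurable_prepend_right x))
    (measurable_walkPath_right _)]
  simp only [walkPath_prepend]

lemma measurable_lintegral_walkLaw {f : (ℕ → ℝ) → ℝ≥0∞} (hf : Measurable f) :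
    Measurable fun x => ∫⁻ s, f s ∂walkLaw μ x :=
  hf.lintegral_kernel

lemma walkLaw_eq_lintegral {S : Set (ℕ → ℝ)} (hS : MeasurableSet S) (x : ℝ) :
    walkLaw μ x S = ∫⁻ z, walkLaw μ (x + z) (prepend x ⁻¹' S) ∂μ := by
  have h := lintegral_walkLaw (μ := μ) (measurable_one.indicator hS) x
  rw [lintegral_indicator_one hS] at h
  rw [h]
  refine lintegral_congr fun z => ?_
  rw [← lintegral_indicator_one (measurable_prepend_right x hS)]
  rfl

lemma measurable_walkLaw_apply {S : Set (ℕ → ℝ)} (hS : MeasurableSet S) :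
    Measurable fun x => walkLaw μ x S :=
  (walkLaw μ).measurable_coe hS

lemma walkLaw_tail_preimage {S : Set (ℕ → ℝ)} (hS : MeasurableSet S) (x : ℝ) :
    walkLaw μ x (tail ⁻¹' S) = ∫⁻ z, walkLaw μ (x + z) S ∂μ :=
  walkLaw_eq_lintegral (measurable_tail hS) x

lemma ae_walkLaw_zero (x : ℝ) : ∀ᵐ s ∂walkLaw μ x, s 0 = x := by
  have hm : MeasurableSet {s : ℕ → ℝ | s 0 = x} :=
    measurableSet_eq_fun (measurable_pi_apply 0) measurable_const
  rw [walkLaw_apply, ae_map_iff (measurable_walkPath_right x).aemeasurable hm]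
  simp [walkPath]

/-- The Markov property at time `n`. -/
lemma lintegral_walkLaw_mul (n : ℕ) : ∀ {g f : (ℕ → ℝ) → ℝ≥0∞}, Measurable g → Measurable f →
    (∀ s s', (∀ i ≤ n, s i = s' i) → g s = g s') → ∀ x : ℝ,
    ∫⁻ s, g s * f (tail^[n] s) ∂walkLaw μ x =
      ∫⁻ s, g s * ∫⁻ t, f t ∂walkLaw μ (s n) ∂walkLaw μ x := by
  induction n with
  | zero =>
    intro g f hg hf hdep x
    -- At time `0` the factor `g` depends on `s 0` alone, which is a.s. `x`, so it is a constant.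
    have h1 : ∀ᵐ s ∂walkLaw μ x, g s = g fun _ => x := by
      filter_upwards [ae_walkLaw_zero (μ := μ) x] with s hs
      exact hdep _ _ fun i hi => by rw [Nat.le_zero.1 hi, hs]
    have h2 : ∫⁻ s, g s * f (tail^[0] s) ∂walkLaw μ x =
        ∫⁻ s, g (fun _ => x) * f s ∂walkLaw μ x :=
      lintegral_congr_ae (by filter_upwards [h1] with s hs; simp [hs])
    have h3 : ∫⁻ s, g s * ∫⁻ t, f t ∂walkLaw μ (s 0) ∂walkLaw μ x =
        ∫⁻ _, g (fun _ => x) * ∫⁻ t, f t ∂walkLaw μ x ∂walkLaw μ x :=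
      lintegral_congr_ae (by
        filter_upwards [h1, ae_walkLaw_zero (μ := μ) x] with s hs hs0; rw [hs, hs0])
    rw [h2, h3, lintegral_const_mul _ hf]
    simp
  | succ n ih =>
    intro g f hg hf hdep x
    have hf' : Measurable fun s : ℕ → ℝ => f (tail^[n + 1] s) :=
      hf.comp (measurable_tail.iterate (n + 1))
    have hp : Measurable fun s : ℕ → ℝ => ∫⁻ t, f t ∂walkLaw μ (s (n + 1)) :=
      (measurable_lintegral_walkLaw hf).comp (measurable_pi_apply (n + 1))
    rw [lintegral_walkLaw (f := fun s => g s * f (tail^[n + 1] s)) (hg.mul hf'),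
      lintegral_walkLaw (f := fun s => g s * ∫⁻ t, f t ∂walkLaw μ (s (n + 1))) (hg.mul hp)]
    refine lintegral_congr fun z => ?_
    simp only [Function.iterate_succ_apply, tail_prepend, prepend_succ]
    exact ih (g := fun s => g (prepend x s)) (hg.comp (measurable_prepend_right x)) hf
      (fun s s' hs => hdep _ _ fun i hi => by
        cases i with
        | zero => rfl
        | succ i => exact hs i (by omega)) (x + z)

/-- The laws of the walk from different starting points are translations of each other. -/
lemma walkLaw_add (x y : ℝ) :
    walkLaw μ (x + y) = (walkLaw μ x).map fun s n => s n + y := by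
  rw [walkLaw_apply, walkLaw_apply, Measure.map_map (by fun_prop) (measurable_walkPath_right x)]
  congr 1
  funext ξ n
  simp only [walkPath, Function.comp]
  ring

lemma ae_walkLaw_add {p : (ℕ → ℝ) → Prop} {x : ℝ} (y : ℝ)
    (h : ∀ᵐ s ∂walkLaw μ (x + y), p s) : ∀ᵐ s ∂walkLaw μ x, p fun n => s n + y := by
  rw [walkLaw_add] at h
  have hm : Measurable fun (s : ℕ → ℝ) (n : ℕ) => s n + y := by fun_prop
  exact ae_of_ae_map hm.aemeasurable h

/-- Almost sure properties of the increments. -/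
lemma ae_walkLaw_of_increments {p : (ℕ → ℝ) → Prop} {x : ℝ} {S : Set ℝ} (hS : S ∈ ae μ)
    (h : ∀ ξ : ℕ → ℝ, (∀ i, ξ i ∈ S) → p (walkPath x ξ)) : ∀ᵐ s ∂walkLaw μ x, p s := by
  -- `S` need not be measurable, so it is replaced by a measurable subset of full measure.
  obtain ⟨T, hTS, hT, hT1⟩ : ∃ T ⊆ S, MeasurableSet T ∧ T ∈ ae μ := by
    refine ⟨(toMeasurable μ Sᶜ)ᶜ, ?_, (measurableSet_toMeasurable _ _).compl, ?_⟩
    · exact Set.compl_subset_comm.1 (subset_toMeasurable μ Sᶜ)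
    · rw [mem_ae_iff, compl_compl, measure_toMeasurable]
      exact mem_ae_iff.1 hS
  have hae : ∀ᵐ ξ ∂(Measure.infinitePi fun _ : ℕ => μ), ∀ i, ξ i ∈ T := by
    refine ae_all_iff.2 fun i => ?_
    have := (measurePreserving_eval_infinitePi (fun _ : ℕ => μ) i).quasiMeasurePreserving.ae
      (p := fun z => z ∈ T) hT1
    exact this
  have hmeas : MeasurableSet {s : ℕ → ℝ | s 0 = x ∧ ∀ i, s (i + 1) - s i ∈ T} := by
    have heq : {s : ℕ → ℝ | s 0 = x ∧ ∀ i, s (i + 1) - s i ∈ T} =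
        {s : ℕ → ℝ | s 0 = x} ∩ ⋂ i, (fun s : ℕ → ℝ => s (i + 1) - s i) ⁻¹' T := by
      ext s; simp
    rw [heq]
    refine (measurableSet_eq_fun (measurable_pi_apply 0) measurable_const).inter ?_
    refine MeasurableSet.iInter fun i => ?_
    have : Measurable fun s : ℕ → ℝ => s (i + 1) - s i := by fun_prop
    exact this hT
  have h1 : ∀ᵐ s ∂walkLaw μ x, s 0 = x ∧ ∀ i, s (i + 1) - s i ∈ T := by
    rw [walkLaw_apply, ae_map_iff (measurable_walkPath_right x).aemeasurable hmeas]
    filter_upwards [hae] with ξ hξ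
    refine ⟨by simp [walkPath], fun i => ?_⟩
    simpa [walkPath, Finset.sum_range_succ] using hξ i
  filter_upwards [h1] with s hs
  have hs' : s = walkPath x fun i => s (i + 1) - s i := by
    funext n
    rw [walkPath, Finset.sum_range_sub, hs.1]
    ring
  rw [hs']
  exact h _ fun i => hTS (hs.2 i)

end

/-! ### The state space and visits to open sets -/

section

variable {μ : Measure ℝ}

lemma isClosed_stateSpace : IsClosed (stateSpace μ : Set ℝ) :=
  AddSubgroup.isClosed_topologicalClosure _

lemma measurableSet_stateSpace : MeasurableSet (stateSpace μ : Set ℝ) :=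
  isClosed_stateSpace.measurableSet

lemma support_subset_stateSpace : μ.support ⊆ stateSpace μ :=
  AddSubgroup.subset_closure.trans (AddSubgroup.le_topologicalClosure _)

lemma ae_mem_stateSpace : ∀ᵐ z ∂μ, z ∈ stateSpace μ := by
  filter_upwards [μ.support_mem_ae] with z hz
  exact support_subset_stateSpace hz

end

lemma measurableSet_frequently {G : Set ℝ} (hG : MeasurableSet G) :
    MeasurableSet {s : ℕ → ℝ | ∃ᶠ n in atTop, s n ∈ G} := by
  have : {s : ℕ → ℝ | ∃ᶠ n in atTop, s n ∈ G} =
      limsup (fun n => (fun s : ℕ → ℝ => s n) ⁻¹' G) atTop := by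
    ext s
    rw [mem_limsup_iff_frequently_mem]
    rfl
  rw [this]
  exact MeasurableSet.measurableSet_limsup fun n => measurable_pi_apply n hG

variable {μ : Measure ℝ} [IsProbabilityMeasure μ]

/-- The walks from `x` and from `y` differ by the constant `y - x`, so visits of one to a ball of
radius `ε / 2` are visits of the other to the ball of radius `ε`. -/
lemma ae_walkLaw_of_near {x : ℝ}
    (h : ∀ δ > 0, ∃ y, dist x y < δ ∧ ∀ᵐ s ∂walkLaw μ y, ∃ᶠ n in atTop, s n ∈ Metric.ball 0 δ) :
    ∀ ε > 0, ∀ᵐ s ∂walkLaw μ x, ∃ᶠ n in atTop, s n ∈ Metric.ball 0 ε := by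
  intro ε hε
  obtain ⟨y, hy, h⟩ := h (ε / 2) (half_pos hε)
  have h' : ∀ᵐ s ∂walkLaw μ (x + (y - x)), ∃ᶠ n in atTop, s n ∈ Metric.ball 0 (ε / 2) := by
    simpa using h
  filter_upwards [ae_walkLaw_add _ h'] with s hs
  refine hs.mono fun n hn => ?_
  rw [Real.dist_eq, abs_lt] at hy
  rw [mem_ball_zero_iff, Real.norm_eq_abs, abs_lt] at hn ⊢
  constructor <;> linarith [hy.1, hy.2, hn.1, hn.2]

/-- Visiting a ball infinitely often does not depend on the first step, so it stays almost sure from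
`x + w` for `μ`-a.e. `w`. Since `z` is in the support, such `w` exist arbitrarily close to `z`. -/
lemma ae_walkLaw_add_of_mem_support {x z : ℝ} (hz : z ∈ μ.support)
    (h : ∀ ε > 0, ∀ᵐ s ∂walkLaw μ x, ∃ᶠ n in atTop, s n ∈ Metric.ball 0 ε) :
    ∀ ε > 0, ∀ᵐ s ∂walkLaw μ (x + z), ∃ᶠ n in atTop, s n ∈ Metric.ball 0 ε := by
  refine ae_walkLaw_of_near fun δ hδ => ?_
  set S : Set (ℕ → ℝ) := {s | ∃ᶠ n in atTop, s n ∈ Metric.ball 0 δ} with hS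
  have hSm : MeasurableSet S := measurableSet_frequently measurableSet_ball
  have htail : tail ⁻¹' Sᶜ = Sᶜ := by
    rw [Set.preimage_compl]
    congr 1
    ext s
    change (∃ᶠ n in atTop, s (n + 1) ∈ Metric.ball 0 δ) ↔ ∃ᶠ n in atTop, s n ∈ Metric.ball 0 δ
    conv_rhs => rw [← map_add_atTop_eq_nat 1, frequently_map]
  have h0 : ∫⁻ w, walkLaw μ (x + w) Sᶜ ∂μ = 0 := by
    rw [← walkLaw_tail_preimage hSm.compl, htail]
    exact h δ hδ
  have hm : Measurable fun w => walkLaw μ (x + w) Sᶜ :=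
    (measurable_walkLaw_apply hSm.compl).comp (measurable_const_add x)
  rw [lintegral_eq_zero_iff hm] at h0
  have hpos := (Measure.mem_support_iff_forall z).1 hz _ (Metric.ball_mem_nhds z hδ)
  obtain ⟨w, hw, hw0⟩ : ∃ w ∈ Metric.ball z δ, walkLaw μ (x + w) Sᶜ = 0 := by
    by_contra! hcon
    refine hpos.ne' (measure_mono_null (fun w hw => ?_) h0)
    exact hcon w hw
  refine ⟨x + w, ?_, hw0⟩
  rw [dist_add_left, dist_comm]
  exact hw

lemma ae_walkLaw_of_mem_closure_support (hrec : TopologicallyRecurrent μ) {x : ℝ}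
    (hx : x ∈ AddSubmonoid.closure μ.support) :
    ∀ ε > 0, ∀ᵐ s ∂walkLaw μ x, ∃ᶠ n in atTop, s n ∈ Metric.ball 0 ε := by
  induction hx using AddSubmonoid.closure_induction_right with
  | zero =>
    intro ε hε
    exact (mem_ae_iff_prob_eq_one (measurableSet_frequently measurableSet_ball)).2
      (hrec _ Metric.isOpen_ball (Metric.mem_ball_self hε))
  | add_right x _ z hz ih => exact ae_walkLaw_add_of_mem_support hz ih

/-- The walk from `x` returns near `0`, so the walk from `0` comes near `-x`; the latter never
leaves the semigroup generated by the support. -/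
lemma neg_mem_closure_of_mem (hrec : TopologicallyRecurrent μ) {x : ℝ}
    (hx : x ∈ AddSubmonoid.closure μ.support) :
    -x ∈ closure (AddSubmonoid.closure μ.support : Set ℝ) := by
  refine Metric.mem_closure_iff.2 fun ε hε => ?_
  have h := ae_walkLaw_of_mem_closure_support hrec hx ε hε
  rw [← zero_add x] at h
  have h2 : ∀ᵐ s ∂walkLaw μ 0, ∀ n, s n ∈ AddSubmonoid.closure μ.support :=
    ae_walkLaw_of_increments μ.support_mem_ae fun ξ hξ n =>
      add_mem (zero_mem _) (sum_mem fun i _ => AddSubmonoid.subset_closure (hξ i))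
  obtain ⟨s, hs, hs2⟩ := ((ae_walkLaw_add _ h).and h2).exists
  obtain ⟨n, hn⟩ := hs.exists
  refine ⟨s n, hs2 n, ?_⟩
  rw [mem_ball_zero_iff, Real.norm_eq_abs] at hn
  rwa [dist_comm, Real.dist_eq, sub_neg_eq_add]

/-- Under recurrence the closed semigroup generated by the support is already a group, so finite
sums of points of the support are dense in the state space. -/
lemma stateSpace_subset_closure (hrec : TopologicallyRecurrent μ) :
    (stateSpace μ : Set ℝ) ⊆ closure (AddSubmonoid.closure μ.support : Set ℝ) := by
  let T : AddSubgroup ℝ :=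
    { (AddSubmonoid.closure μ.support).topologicalClosure with
      neg_mem' := by
        intro x hx
        have := map_mem_closure (t := closure (AddSubmonoid.closure μ.support : Set ℝ))
          continuous_neg hx fun y hy => neg_mem_closure_of_mem hrec hy
        rwa [closure_closure] at this }
  have hT : (T : Set ℝ) = closure (AddSubmonoid.closure μ.support : Set ℝ) := rfl
  rw [← hT]
  refine AddSubgroup.topologicalClosure_minimal (t := T) _ ?_ (by rw [hT]; exact isClosed_closure)
  rw [AddSubgroup.closure_le, hT]
  exact AddSubmonoid.subset_closure.trans subset_closure

/-- A topologically recurrent walk started in its state space visits every open set that meets the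
state space infinitely often. -/
theorem ae_frequently_mem (hrec : TopologicallyRecurrent μ) {x y : ℝ} {G : Set ℝ}
    (hx : x ∈ stateSpace μ) (hG : IsOpen G) (hy : y ∈ stateSpace μ) (hyG : y ∈ G) :
    ∀ᵐ s ∂walkLaw μ x, ∃ᶠ n in atTop, s n ∈ G := by
  have hxy : x - y ∈ closure (AddSubmonoid.closure μ.support : Set ℝ) :=
    stateSpace_subset_closure hrec (sub_mem hx hy)
  obtain ⟨ε, hε, hεG⟩ := Metric.isOpen_iff.1 hG y hyG
  have h := ae_walkLaw_of_near (μ := μ) (x := x - y) (fun δ hδ => by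
    obtain ⟨w, hw, hwd⟩ := Metric.mem_closure_iff.1 hxy δ hδ
    exact ⟨w, hwd, ae_walkLaw_of_mem_closure_support hrec hw δ hδ⟩) ε hε
  rw [sub_eq_add_neg] at h
  filter_upwards [ae_walkLaw_add _ h] with s hs
  refine hs.mono fun n hn => hεG ?_
  rwa [mem_ball_zero_iff, ← sub_eq_add_neg, ← dist_eq_norm] at hn

/-! ### Superharmonic functions -/

section

variable {μ : Measure ℝ} [IsProbabilityMeasure μ]

lemma measurableSet_exists_le_mem {G : Set ℝ} (hG : MeasurableSet G) (n : ℕ) :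
    MeasurableSet {s : ℕ → ℝ | ∃ k ≤ n, s k ∈ G} := by
  have : {s : ℕ → ℝ | ∃ k ≤ n, s k ∈ G} = ⋃ k ∈ Set.Iic n, (fun s : ℕ → ℝ => s k) ⁻¹' G := by
    ext s; simp
  rw [this]
  exact MeasurableSet.biUnion (Set.to_countable _) fun k _ => measurable_pi_apply k hG

/-- The maximal inequality for the nonnegative supermartingale `φ(Sₙ)`, obtained by induction on the
horizon through the first step. -/
lemma mul_walkLaw_le_of_superharmonic {φ : ℝ → ℝ≥0∞}
    (hsup : ∀ x ∈ stateSpace μ, ∫⁻ z, φ (x + z) ∂μ ≤ φ x) {G : Set ℝ} (hG : MeasurableSet G)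
    {a : ℝ≥0∞} (ha : ∀ x ∈ G, a ≤ φ x) (n : ℕ) : ∀ {x : ℝ}, x ∈ stateSpace μ →
    a * walkLaw μ x {s | ∃ k ≤ n, s k ∈ G} ≤ φ x := by
  have hin {x : ℝ} (hx : x ∈ G) (S : Set (ℕ → ℝ)) : a * walkLaw μ x S ≤ φ x :=
    (mul_le_of_le_one_right' prob_le_one).trans (ha x hx)
  induction n with
  | zero =>
    intro x _
    by_cases hxG : x ∈ G
    · exact hin hxG _
    · have : walkLaw μ x {s | ∃ k ≤ 0, s k ∈ G} = 0 := by
        refine measure_mono_null ?_ (ae_walkLaw_zero (μ := μ) x)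
        rintro s ⟨k, hk, hs⟩ h0
        rw [Nat.le_zero.1 hk, h0] at hs
        exact hxG hs
      rw [this, mul_zero]
      exact zero_le
  | succ n ih =>
    intro x hx
    by_cases hxG : x ∈ G
    · exact hin hxG _
    · have hm := measurableSet_exists_le_mem hG n
      have h1 : walkLaw μ x {s | ∃ k ≤ n + 1, s k ∈ G} ≤
          walkLaw μ x (tail ⁻¹' {s | ∃ k ≤ n, s k ∈ G}) := by
        refine measure_mono_ae ?_
        filter_upwards [ae_walkLaw_zero (μ := μ) x] with s h0
        rintro ⟨k, hk, hs⟩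
        cases k with
        | zero => rw [h0] at hs; exact absurd hs hxG
        | succ k => exact ⟨k, by omega, hs⟩
      calc a * walkLaw μ x {s | ∃ k ≤ n + 1, s k ∈ G}
          ≤ a * ∫⁻ z, walkLaw μ (x + z) {s | ∃ k ≤ n, s k ∈ G} ∂μ := by
            rw [← walkLaw_tail_preimage hm]; gcongr
        _ = ∫⁻ z, a * walkLaw μ (x + z) {s | ∃ k ≤ n, s k ∈ G} ∂μ := by
            rw [lintegral_const_mul]
            exact (measurable_walkLaw_apply hm).comp (measurable_const_add x)
        _ ≤ ∫⁻ z, φ (x + z) ∂μ := by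
            refine lintegral_mono_ae ?_
            filter_upwards [ae_mem_stateSpace (μ := μ)] with z hz
            exact ih (add_mem hx hz)
        _ ≤ φ x := hsup x hx

/-- For `b < φ y` the open set `{φ > b}` contains `y`, so the walk from `x` hits it almost surely,
and the maximal inequality gives `b ≤ φ x`. As `x` and `y` are arbitrary, `φ` is constant on the
state space. -/
lemma le_of_superharmonic (hrec : TopologicallyRecurrent μ) {φ : ℝ → ℝ≥0∞}
    (hsup : ∀ x ∈ stateSpace μ, ∫⁻ z, φ (x + z) ∂μ ≤ φ x)
    (hlsc : ∀ a, IsClosed {y | φ y ≤ a}) {x y : ℝ} (hx : x ∈ stateSpace μ)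
    (hy : y ∈ stateSpace μ) : φ y ≤ φ x := by
  refine le_of_forall_lt fun a ha => ?_
  obtain ⟨b, hab, hb⟩ := exists_between ha
  refine hab.trans_le ?_
  set G : Set ℝ := {y | φ y ≤ b}ᶜ with hGdef
  have hG : IsOpen G := (hlsc b).isOpen_compl
  have hlim : Tendsto (fun n => b * walkLaw μ x {s | ∃ k ≤ n, s k ∈ G}) atTop (𝓝 (b * 1)) := by
    refine ENNReal.Tendsto.const_mul ?_ (Or.inl one_ne_zero)
    have hmono : Monotone fun n : ℕ => {s : ℕ → ℝ | ∃ k ≤ n, s k ∈ G} :=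
      fun m n hmn s ⟨k, hk, hs⟩ => ⟨k, hk.trans hmn, hs⟩
    have h1 : walkLaw μ x (⋃ n : ℕ, {s : ℕ → ℝ | ∃ k ≤ n, s k ∈ G}) = 1 := by
      refine (mem_ae_iff_prob_eq_one
        (MeasurableSet.iUnion fun n => measurableSet_exists_le_mem hG.measurableSet n)).1 ?_
      filter_upwards [ae_frequently_mem hrec hx hG hy (not_le.2 hb)] with s hs
      obtain ⟨k, hk⟩ := hs.exists
      exact Set.mem_iUnion.2 ⟨k, k, le_rfl, hk⟩
    rw [← h1]
    exact tendsto_measure_iUnion_atTop hmono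
  rw [mul_one] at hlim
  exact le_of_tendsto' hlim fun n => mul_walkLaw_le_of_superharmonic hsup hG.measurableSet
    (fun z (hz : ¬ φ z ≤ b) => (not_le.1 hz).le) n hx

end

/-- The map `y ↦ m (U - y)` is lower semicontinuous for open `U`. -/
lemma isClosed_measure_preimage_add_le {m : Measure ℝ} {U : Set ℝ} (hU : IsOpen U) (a : ℝ≥0∞) :
    IsClosed {y : ℝ | m ((fun x => x + y) ⁻¹' U) ≤ a} := by
  refine IsSeqClosed.isClosed fun u y hu huy => ?_
  have hmeas (w : ℝ) : MeasurableSet ((fun x => x + w) ⁻¹' U) :=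
    measurable_add_const w hU.measurableSet
  -- As `U` is open, the indicator of `U - y` is at most the lower limit of the indicators of `U - u
  -- n`; Fatou's lemma does the rest.
  have hle (x : ℝ) : ((fun x => x + y) ⁻¹' U).indicator (1 : ℝ → ℝ≥0∞) x ≤
      liminf (fun n => ((fun x => x + u n) ⁻¹' U).indicator (1 : ℝ → ℝ≥0∞) x) atTop := by
    by_cases hx : x + y ∈ U
    · have hev : ∀ᶠ n in atTop, x + u n ∈ U :=
        (huy.const_add x).eventually (hU.mem_nhds hx)
      have h1 : ((fun x => x + y) ⁻¹' U).indicator (1 : ℝ → ℝ≥0∞) x = 1 :=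
        Set.indicator_of_mem (by exact hx) _
      rw [h1]
      refine le_liminf_of_le (by isBoundedDefault) ?_
      filter_upwards [hev] with n hn
      rw [Set.indicator_of_mem (by exact hn)]
      rfl
    · rw [Set.indicator_of_notMem (by exact hx)]
      exact zero_le
  change m ((fun x => x + y) ⁻¹' U) ≤ a
  rw [← lintegral_indicator_one (hmeas y)]
  refine (lintegral_mono hle).trans ((lintegral_liminf_le fun n =>
    measurable_one.indicator (hmeas _)).trans ?_)
  simp only [lintegral_indicator_one (hmeas _)]
  exact liminf_le_of_frequently_le' (Frequently.of_forall hu)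

/-! ### Haar measure and the rigidity of excessive measures and functions -/

section Haar

variable {μ : Measure ℝ}

instance : LocallyCompactSpace (stateSpace μ) :=
  isClosed_stateSpace.isClosedEmbedding_subtypeVal.locallyCompactSpace

lemma measurableEmbedding_stateSpace_val :
    MeasurableEmbedding (Subtype.val : stateSpace μ → ℝ) :=
  MeasurableEmbedding.subtype_coe measurableSet_stateSpace

/-- A locally finite measure on the state space that is invariant under its translations is a
Haar measure. -/
lemma eq_smul_onReal_of_translation_invariant {m : Measure ℝ} [IsLocallyFiniteMeasure m]
    (lam : Measure (stateSpace μ)) [lam.IsAddHaarMeasure] (hm : m (stateSpace μ : Set ℝ)ᶜ = 0)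
    (hinv : ∀ y ∈ stateSpace μ, m.map (fun x => x + y) = m) : ∃ c : ℝ≥0, m = c • onReal lam := by
  have hval := measurableEmbedding_stateSpace_val (μ := μ)
  set m' : Measure (stateSpace μ) := m.comap Subtype.val with hm'
  have hleft : m'.IsAddLeftInvariant := by
    refine ⟨fun g => ?_⟩
    ext S hS
    rw [Measure.map_apply (measurable_const_add g) hS, hm', hval.comap_apply, hval.comap_apply]
    conv_rhs => rw [← hinv g g.2, Measure.map_apply (measurable_add_const _)
      (hval.measurableSet_image.2 hS)]
    congr 1
    ext x
    simp only [Set.mem_image, Set.mem_preimage, Subtype.exists, exists_and_right, exists_eq_right]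
    constructor
    · rintro ⟨hx, h⟩
      exact ⟨add_mem hx g.2, by rwa [add_comm] at h⟩
    · rintro ⟨hx, h⟩
      refine ⟨by simpa using sub_mem hx g.2, ?_⟩
      rw [add_comm]; exact h
  have hfin : IsFiniteMeasureOnCompacts m' := by
    refine ⟨fun K hK => ?_⟩
    rw [hm', hval.comap_apply]
    exact (hK.image continuous_subtype_val).measure_lt_top
  refine ⟨Measure.addHaarScalarFactor m' lam, ?_⟩
  have h1 := Measure.isAddLeftInvariant_eq_smul m' lam
  have h2 : m'.map Subtype.val = m := by
    rw [hm', hval.map_comap, Measure.restrict_eq_self_of_ae_mem]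
    rw [Subtype.range_coe_subtype]
    exact hm
  rw [← h2, onReal]
  conv_lhs => rw [h1]
  exact Measure.map_smul _ _ _

variable (lam : Measure (stateSpace μ))

lemma onReal_compl : onReal lam (stateSpace μ : Set ℝ)ᶜ = 0 := by
  rw [onReal, Measure.map_apply measurable_subtype_coe measurableSet_stateSpace.compl]
  have : (Subtype.val : stateSpace μ → ℝ) ⁻¹' (stateSpace μ : Set ℝ)ᶜ = ∅ := by
    ext x; simp
  rw [this, measure_empty]

lemma ae_onReal_mem : ∀ᵐ x ∂onReal lam, x ∈ stateSpace μ := onReal_compl lam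

variable [lam.IsAddHaarMeasure]

instance : IsLocallyFiniteMeasure (onReal lam) := by
  refine ⟨fun x => ⟨Metric.closedBall x 1, Metric.closedBall_mem_nhds x one_pos, ?_⟩⟩
  rw [onReal, Measure.map_apply measurable_subtype_coe measurableSet_closedBall]
  exact (isClosed_stateSpace.isClosedEmbedding_subtypeVal.isCompact_preimage
    (isCompact_closedBall x 1)).measure_lt_top

lemma onReal_pos_of_isOpen {G : Set ℝ} (hG : IsOpen G) {x : ℝ} (hx : x ∈ stateSpace μ)
    (hxG : x ∈ G) : 0 < onReal lam G := by
  rw [onReal, Measure.map_apply measurable_subtype_coe hG.measurableSet]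
  exact (hG.preimage continuous_subtype_val).measure_pos lam ⟨⟨x, hx⟩, hxG⟩

lemma map_add_onReal {y : ℝ} (hy : y ∈ stateSpace μ) :
    (onReal lam).map (fun x => x + y) = onReal lam := by
  have h : (fun x : ℝ => x + y) ∘ (Subtype.val : stateSpace μ → ℝ) =
      Subtype.val ∘ fun x : stateSpace μ => x + ⟨y, hy⟩ := rfl
  rw [onReal, Measure.map_map (measurable_add_const y) measurable_subtype_coe, h,
    ← Measure.map_map measurable_subtype_coe (measurable_add_const _), map_add_right_eq_self]

lemma map_neg_onReal : (onReal lam).map (fun x => -x) = onReal lam := by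
  have h : (fun x : ℝ => -x) ∘ (Subtype.val : stateSpace μ → ℝ) =
      Subtype.val ∘ fun x : stateSpace μ => -x := rfl
  rw [onReal, Measure.map_map measurable_neg measurable_subtype_coe, h,
    ← Measure.map_map measurable_subtype_coe measurable_neg]
  congr 1
  exact Measure.map_neg_eq_self lam

lemma lintegral_add_onReal {y : ℝ} (hy : y ∈ stateSpace μ) {f : ℝ → ℝ≥0∞} (hf : Measurable f) :
    ∫⁻ x, f (x + y) ∂onReal lam = ∫⁻ x, f x ∂onReal lam := by
  conv_rhs => rw [← map_add_onReal lam hy, lintegral_map hf (measurable_add_const y)]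

lemma onReal_ne_zero : onReal lam ≠ 0 := by
  intro h
  have := onReal_pos_of_isOpen lam isOpen_univ (zero_mem _) (Set.mem_univ 0)
  simp [h] at this

/-- The Haar measure is invariant for the walk. -/
lemma lintegral_step_onReal [IsProbabilityMeasure μ] {f : ℝ → ℝ≥0∞} (hf : Measurable f) :
    ∫⁻ x, ∫⁻ z, f (x + z) ∂μ ∂onReal lam = ∫⁻ x, f x ∂onReal lam := by
  rw [lintegral_lintegral_swap (by fun_prop)]
  have : ∀ᵐ z ∂μ, ∫⁻ x, f (x + z) ∂onReal lam = ∫⁻ x, f x ∂onReal lam := by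
    filter_upwards [ae_mem_stateSpace (μ := μ)] with z hz
    exact lintegral_add_onReal lam hz hf
  rw [lintegral_congr_ae this]
  simp

variable {lam} [IsProbabilityMeasure μ]

/-- A locally finite excessive measure of a topologically recurrent walk is a multiple of the Haar
measure. -/
theorem eq_smul_onReal_of_excessive (hrec : TopologicallyRecurrent μ) {m : Measure ℝ}
    [IsLocallyFiniteMeasure m] (hm : m (stateSpace μ : Set ℝ)ᶜ = 0)
    (hexc : ∀ f : ℝ → ℝ≥0∞, Measurable f → ∫⁻ x, ∫⁻ z, f (x + z) ∂μ ∂m ≤ ∫⁻ x, f x ∂m) :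
    ∃ c : ℝ≥0, m = c • onReal lam := by
  -- The function `y ↦ m (U - y)` inherits superharmonicity from the excessivity of `m`; exchanging
  -- `x` and `y` below turns the inequality into an equality.
  have hopen {U : Set ℝ} (hU : IsOpen U) {x y : ℝ} (hx : x ∈ stateSpace μ)
      (hy : y ∈ stateSpace μ) :
      m ((fun w => w + y) ⁻¹' U) ≤ m ((fun w => w + x) ⁻¹' U) := by
    refine le_of_superharmonic hrec (φ := fun y => m ((fun w => w + y) ⁻¹' U)) (fun y _ => ?_)
      (isClosed_measure_preimage_add_le hU) hx hy
    have hmeas (w : ℝ) : MeasurableSet ((fun x => x + w) ⁻¹' U) :=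
      measurable_add_const w hU.measurableSet
    have hind : Measurable (U.indicator (1 : ℝ → ℝ≥0∞)) :=
      measurable_one.indicator hU.measurableSet
    have hform (w : ℝ) : m ((fun x => x + w) ⁻¹' U) = ∫⁻ x, U.indicator 1 (x + w) ∂m := by
      rw [← lintegral_indicator_one (hmeas w)]
      rfl
    have hexc' := hexc (fun x => U.indicator 1 (x + y)) (by fun_prop)
    simp only [hform]
    rw [lintegral_lintegral_swap (by fun_prop)]
    refine le_of_eq_of_le (lintegral_congr fun x => lintegral_congr fun z => ?_) hexc'
    rw [← add_assoc, add_right_comm]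
  refine eq_smul_onReal_of_translation_invariant lam hm fun y hy => ?_
  symm
  refine Real.measure_ext_Ioo_rat fun a b => ?_
  rw [Measure.map_apply (measurable_add_const y) measurableSet_Ioo]
  have h1 := hopen (U := Set.Ioo (a : ℝ) b) isOpen_Ioo (zero_mem _) hy
  have h2 := hopen (U := Set.Ioo (a : ℝ) b) isOpen_Ioo hy (zero_mem _)
  simp only [add_zero, Set.preimage_id'] at h1 h2
  exact le_antisymm h2 h1

/-- A bounded excessive function of a topologically recurrent walk is constant almost
everywhere. -/
theorem ae_eq_const_of_excessive (hrec : TopologicallyRecurrent μ) {v : ℝ → ℝ≥0∞}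
    (hv : Measurable v) (hv1 : ∀ x, v x ≤ 1)
    (hexc : ∀ x ∈ stateSpace μ, ∫⁻ z, v (x + z) ∂μ ≤ v x) :
    ∃ c : ℝ≥0, ∀ᵐ x ∂onReal lam, v x = c := by
  set L := onReal lam with hL
  -- Reflection turns the excessive function `v` into a density: the `λ`-dual of the walk has steps
  -- `-X₁`, and `x ↦ -x` maps it back to the walk. Hence `w λ` is an excessive measure and rigidity
  -- applies.
  set w : ℝ → ℝ≥0∞ := fun x => v (-x) with hw
  have hwm : Measurable w := hv.comp measurable_neg
  have hle : L.withDensity w ≤ L := by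
    calc L.withDensity w ≤ L.withDensity 1 := withDensity_mono (ae_of_all _ fun x => hv1 _)
      _ = L := withDensity_one
  have : IsLocallyFiniteMeasure (L.withDensity w) := Measure.isLocallyFiniteMeasure_of_le hle
  have h0 : L.withDensity w (stateSpace μ : Set ℝ)ᶜ = 0 :=
    le_antisymm ((hle _).trans (onReal_compl lam).le) zero_le
  obtain ⟨c, hc⟩ := eq_smul_onReal_of_excessive (lam := lam) hrec h0 fun f hf => by
    rw [lintegral_withDensity_eq_lintegral_mul _ hwm (by fun_prop),
      lintegral_withDensity_eq_lintegral_mul _ hwm hf]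
    calc ∫⁻ x, (w * fun x => ∫⁻ z, f (x + z) ∂μ) x ∂L
        = ∫⁻ x, ∫⁻ z, w x * f (x + z) ∂μ ∂L := by
          refine lintegral_congr fun x => ?_
          rw [lintegral_const_mul _ (by fun_prop)]
          rfl
      _ = ∫⁻ z, ∫⁻ x, w x * f (x + z) ∂L ∂μ := lintegral_lintegral_swap (by fun_prop)
      _ = ∫⁻ z, ∫⁻ x, w (x + -z) * f x ∂L ∂μ := by
          refine lintegral_congr_ae ?_
          filter_upwards [ae_mem_stateSpace (μ := μ)] with z hz
          rw [← lintegral_add_onReal lam hz (f := fun x => w (x + -z) * f x) (by fun_prop)]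
          simp [hL]
      _ = ∫⁻ x, ∫⁻ z, w (x + -z) * f x ∂μ ∂L := lintegral_lintegral_swap (by fun_prop)
      _ ≤ ∫⁻ x, (w * f) x ∂L := by
          refine lintegral_mono_ae ?_
          filter_upwards [ae_onReal_mem lam] with x hx
          rw [lintegral_mul_const _ (by fun_prop)]
          refine mul_le_mul_left ?_ _
          have := hexc (-x) (neg_mem hx)
          convert this using 3
          simp only [hw]
          congr 1
          ring
  refine ⟨c, ?_⟩
  have hconst : (c • L : Measure ℝ) = L.withDensity fun _ => (c : ℝ≥0∞) := by
    rw [withDensity_const]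
    rfl
  -- Densities with respect to a σ-finite measure are determined almost everywhere; what remains is
  -- to undo the reflection, which preserves `λ`.
  rw [hconst, withDensity_eq_iff_of_sigmaFinite hwm.aemeasurable (by fun_prop)] at hc
  have hS : MeasurableSet {x | v x = c} := hv (measurableSet_singleton _)
  have h2 : ∀ᵐ x ∂L.map (fun x => -x), v x = c := by
    rw [ae_map_iff measurable_neg.aemeasurable hS]
    exact hc
  rwa [hL, map_neg_onReal] at h2

end Haar

/-! ### Triviality of shift-invariant events -/

variable {μ : Measure ℝ} [IsProbabilityMeasure μ]

lemma walkLaw_mem_zero {N : Set ℝ} (hN : MeasurableSet N) (x : ℝ) :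
    walkLaw μ x {s | s 0 ∈ N} = N.indicator 1 x := by
  have : ∀ᵐ s ∂walkLaw μ x, s 0 ∈ N ↔ x ∈ N := by
    filter_upwards [ae_walkLaw_zero (μ := μ) x] with s hs
    rw [← hs]
  by_cases hx : x ∈ N
  · rw [Set.indicator_of_mem hx]
    refine (mem_ae_iff_prob_eq_one (measurable_pi_apply 0 hN)).1 ?_
    filter_upwards [this] with s hs
    exact hs.2 hx
  · rw [Set.indicator_of_notMem hx]
    refine measure_eq_zero_iff_ae_notMem.2 ?_
    filter_upwards [this] with s hs h
    exact hx (hs.1 h)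

lemma lintegral_walkLaw_mem {m : Measure ℝ}
    (hm : ∀ f : ℝ → ℝ≥0∞, Measurable f → ∫⁻ x, ∫⁻ z, f (x + z) ∂μ ∂m = ∫⁻ x, f x ∂m)
    {N : Set ℝ} (hN : MeasurableSet N) (n : ℕ) : ∫⁻ x, walkLaw μ x {s | s n ∈ N} ∂m = m N := by
  have hS (n : ℕ) : MeasurableSet {s : ℕ → ℝ | s n ∈ N} := measurable_pi_apply n hN
  induction n with
  | zero => simp only [walkLaw_mem_zero hN, lintegral_indicator_one hN]
  | succ n ih =>
    rw [← ih, ← hm _ (measurable_walkLaw_apply (hS n))]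
    exact lintegral_congr fun x => walkLaw_tail_preimage (hS n) x

variable {lam : Measure (stateSpace μ)} [lam.IsAddHaarMeasure]

/-- Started under `λ`, the walk has law `λ` at each time, so a `λ`-null set is a.s. never visited.
-/
lemma ae_walkLaw_forall_of_ae_onReal {p : ℝ → Prop} (hp : ∀ᵐ x ∂onReal lam, p x) :
    ∀ᵐ x ∂onReal lam, ∀ᵐ s ∂walkLaw μ x, ∀ n, p (s n) := by
  set N := toMeasurable (onReal lam) {x | ¬ p x} with hN
  have hNm : MeasurableSet N := measurableSet_toMeasurable _ _
  have hN0 : onReal lam N = 0 := by rw [hN, measure_toMeasurable]; exact hp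
  have hSm (n : ℕ) : MeasurableSet {s : ℕ → ℝ | s n ∈ N} := measurable_pi_apply n hNm
  have hint (n : ℕ) : ∫⁻ x, walkLaw μ x {s | s n ∈ N} ∂onReal lam = 0 := by
    rw [lintegral_walkLaw_mem (fun f hf => lintegral_step_onReal lam hf) hNm, hN0]
  have hall : ∀ᵐ x ∂onReal lam, ∀ n, walkLaw μ x {s | s n ∈ N} = 0 := by
    refine ae_all_iff.2 fun n => ?_
    exact (lintegral_eq_zero_iff (measurable_walkLaw_apply (hSm n))).1 (hint n)
  filter_upwards [hall] with x hx
  refine ae_all_iff.2 fun n => measure_mono_null (fun s hs => ?_) (hx n)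
  exact subset_toMeasurable _ _ hs

/-- Shift-invariant events of a topologically recurrent walk are trivial. -/
theorem ae_eq_zero_or_one_of_tail_invariant (hrec : TopologicallyRecurrent μ)
    {Γ : Set (ℕ → ℝ)} (hΓ : MeasurableSet Γ) (hinv : tail ⁻¹' Γ = Γ) :
    (∀ᵐ x ∂onReal lam, walkLaw μ x Γ = 0) ∨ ∀ᵐ x ∂onReal lam, walkLaw μ x Γ = 1 := by
  obtain ⟨c, hc⟩ := ae_eq_const_of_excessive (lam := lam) hrec (measurable_walkLaw_apply hΓ)
    (fun _ => prob_le_one) fun x _ => by rw [← walkLaw_tail_preimage hΓ, hinv]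
  have hinv' (n : ℕ) (s : ℕ → ℝ) : tail^[n] s ∈ Γ ↔ s ∈ Γ := by
    induction n with
    | zero => rfl
    | succ n ih =>
      rw [Function.iterate_succ_apply', ← ih]
      conv_rhs => rw [← hinv]
      rfl
  have : NeBot (ae (onReal lam)) := ae_neBot.2 (onReal_ne_zero lam)
  obtain ⟨x, hx, hpath⟩ := (hc.and (ae_walkLaw_forall_of_ae_onReal hc)).exists
  -- By the Markov property at time `n` and the constancy of the probability of `Γ`, the event `Γ`
  -- is independent of every cylinder, hence of the whole path.
  have hmeas : (walkLaw μ x).restrict Γ = (c : ℝ≥0∞) • walkLaw μ x := by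
    refine IsProjectiveLimit.unique (P := fun I : Finset ℕ =>
      ((walkLaw μ x).restrict Γ).map I.restrict) (fun I => rfl) fun I => ?_
    symm
    ext A hA
    have hB : MeasurableSet (I.restrict ⁻¹' A : Set (ℕ → ℝ)) := Finset.measurable_restrict I hA
    obtain ⟨n, hn⟩ := I.exists_nat_subset_range
    rw [Measure.map_apply (Finset.measurable_restrict I) hA,
      Measure.map_apply (Finset.measurable_restrict I) hA, Measure.restrict_apply hB,
      Measure.smul_apply, smul_eq_mul]
    have h := lintegral_walkLaw_mul (μ := μ) n
      (g := (I.restrict ⁻¹' A : Set (ℕ → ℝ)).indicator 1) (f := Γ.indicator 1)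
      (measurable_one.indicator hB) (measurable_one.indicator hΓ) (fun s s' hs => by
        have : (I.restrict s : (i : I) → ℝ) = I.restrict s' := by
          funext i
          exact hs i (Finset.mem_range.1 (hn i.2)).le
        classical
        simp only [Set.indicator_apply, Set.mem_preimage, this, Pi.one_apply]) x
    have h1 : ∫⁻ s, (I.restrict ⁻¹' A : Set (ℕ → ℝ)).indicator 1 s *
        Γ.indicator (1 : (ℕ → ℝ) → ℝ≥0∞) (tail^[n] s) ∂walkLaw μ x =
        walkLaw μ x (I.restrict ⁻¹' A ∩ Γ) := by
      rw [← lintegral_indicator_one (hB.inter hΓ)]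
      refine lintegral_congr fun s => ?_
      classical
      simp only [Set.indicator_apply, hinv', Set.mem_inter_iff, Pi.one_apply]
      split_ifs <;> simp_all
    have h2 : ∫⁻ s, (I.restrict ⁻¹' A : Set (ℕ → ℝ)).indicator 1 s *
        ∫⁻ t, Γ.indicator (1 : (ℕ → ℝ) → ℝ≥0∞) t ∂walkLaw μ (s n) ∂walkLaw μ x =
        c * walkLaw μ x (I.restrict ⁻¹' A) := by
      rw [← lintegral_indicator_one hB, mul_comm,
        ← lintegral_mul_const _ (measurable_one.indicator hB)]
      refine lintegral_congr_ae ?_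
      filter_upwards [hpath] with s hs
      rw [lintegral_indicator_one hΓ, hs n]
    rw [← h1, h, h2]
  -- Evaluated at `Γ`, this says that `Γ` is independent of itself.
  have hcc : (c : ℝ≥0∞) = c * c := by
    have := congrArg (fun m => m Γ) hmeas
    simpa only [Measure.restrict_apply_self, Measure.smul_apply, smul_eq_mul, hx] using this
  have hcc' : c = c * c := by exact_mod_cast hcc
  have : c = 0 ∨ c = 1 := by
    rcases eq_or_ne c 0 with h | h
    · exact Or.inl h
    · exact Or.inr (mul_left_cancel₀ h (by rw [← hcc', mul_one]))
  rcases this with rfl | rfl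
  · left; simpa using hc
  · right; simpa using hc

/-! ### Splitting the transition operator by a set of jumps -/

section Jump

/-- The transition operator of the walk restricted to the jumps in `C`. -/
noncomputable def jumpOp (μ : Measure ℝ) (C : Set (ℝ × ℝ)) (f : ℝ → ℝ≥0∞) (x : ℝ) : ℝ≥0∞ :=
  ∫⁻ z, C.indicator (fun p => f p.2) (x, x + z) ∂μ

/-- The image of a measure under the transition operator restricted to the jumps in `C`. -/
noncomputable def jump (μ : Measure ℝ) (C : Set (ℝ × ℝ)) (m : Measure ℝ) : Measure ℝ :=
  (((m.prod μ).map fun p => (p.1, p.1 + p.2)).restrict C).map Prod.snd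

/-- The expected occupation measure of the walk with initial measure `ν` before its first jump
in `C`. -/
noncomputable def occupation (μ : Measure ℝ) (C : Set (ℝ × ℝ)) (ν : Measure ℝ) : Measure ℝ :=
  Measure.sum fun k => (jump μ Cᶜ)^[k] ν

variable {μ : Measure ℝ} {C : Set (ℝ × ℝ)}

lemma jumpOp_add_compl (hC : MeasurableSet C) {f : ℝ → ℝ≥0∞} (hf : Measurable f) (x : ℝ) :
    jumpOp μ C f x + jumpOp μ Cᶜ f x = ∫⁻ z, f (x + z) ∂μ := by
  have h : Measurable (C.indicator fun p : ℝ × ℝ => f p.2) :=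
    (hf.comp measurable_snd).indicator hC
  have h2 : Measurable fun z : ℝ => C.indicator (fun p : ℝ × ℝ => f p.2) (x, x + z) :=
    h.comp (by fun_prop)
  rw [jumpOp, jumpOp, ← lintegral_add_left h2]
  refine lintegral_congr fun z => ?_
  exact Set.indicator_self_add_compl_apply C (fun p : ℝ × ℝ => f p.2) (x, x + z)

variable [IsProbabilityMeasure μ]

lemma measurable_jumpOp (hC : MeasurableSet C) {f : ℝ → ℝ≥0∞} (hf : Measurable f) :
    Measurable (jumpOp μ C f) := by
  have h : Measurable (C.indicator fun p : ℝ × ℝ => f p.2) :=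
    (hf.comp measurable_snd).indicator hC
  have h2 : Measurable fun p : ℝ × ℝ => C.indicator (fun p : ℝ × ℝ => f p.2) (p.1, p.1 + p.2) :=
    h.comp (by fun_prop)
  exact h2.lintegral_prod_right'

lemma measurable_jumpOp_iterate (hC : MeasurableSet C) {f : ℝ → ℝ≥0∞} (hf : Measurable f)
    (n : ℕ) : Measurable ((jumpOp μ C)^[n] f) := by
  induction n with
  | zero => exact hf
  | succ n ih => rw [Function.iterate_succ_apply']; exact measurable_jumpOp hC ih

lemma lintegral_jump (hC : MeasurableSet C) {f : ℝ → ℝ≥0∞} (hf : Measurable f) (m : Measure ℝ) :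
    ∫⁻ x, f x ∂jump μ C m = ∫⁻ x, jumpOp μ C f x ∂m := by
  have h : Measurable (C.indicator fun p : ℝ × ℝ => f p.2) :=
    (hf.comp measurable_snd).indicator hC
  have hp : Measurable fun p : ℝ × ℝ => (p.1, p.1 + p.2) := by fun_prop
  rw [jump, lintegral_map hf measurable_snd, ← lintegral_indicator hC, lintegral_map h hp,
    lintegral_prod (fun p : ℝ × ℝ => C.indicator (fun p => f p.2) (p.1, p.1 + p.2))
      (h.comp hp).aemeasurable]
  rfl

lemma lintegral_jump_iterate (hC : MeasurableSet C) (ν : Measure ℝ) (k : ℕ) :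
    ∀ {f : ℝ → ℝ≥0∞}, Measurable f →
    ∫⁻ x, f x ∂(jump μ C)^[k] ν = ∫⁻ x, (jumpOp μ C)^[k] f x ∂ν := by
  induction k with
  | zero => intro f _; rfl
  | succ k ih =>
    intro f hf
    rw [Function.iterate_succ_apply', lintegral_jump hC hf, ih (measurable_jumpOp hC hf),
      Function.iterate_succ_apply]

/-- The term `k = 0` of the series is `ν` itself, and applying `jump μ Cᶜ` shifts the other terms by
one. -/
lemma lintegral_occupation (hC : MeasurableSet C) {f : ℝ → ℝ≥0∞} (hf : Measurable f)
    (ν : Measure ℝ) :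
    ∫⁻ x, f x ∂occupation μ C ν = ∫⁻ x, f x ∂ν + ∫⁻ x, jumpOp μ Cᶜ f x ∂occupation μ C ν := by
  rw [occupation, lintegral_sum_measure, lintegral_sum_measure,
    tsum_eq_zero_add' ENNReal.summable]
  congr 1
  refine tsum_congr fun k => ?_
  rw [Function.iterate_succ_apply', lintegral_jump hC.compl hf]

lemma jump_compl_eq_zero {A : Set ℝ} (hA : MeasurableSet A) (hC : MeasurableSet C)
    (hCA : ∀ p ∈ C, p.2 ∈ A) {m : Measure ℝ} (hm : m (stateSpace μ : Set ℝ)ᶜ = 0) :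
    jump μ C m ((stateSpace μ : Set ℝ) ∩ A)ᶜ = 0 := by
  have hE : MeasurableSet ((stateSpace μ : Set ℝ) ∩ A)ᶜ :=
    (measurableSet_stateSpace.inter hA).compl
  rw [← lintegral_indicator_one hE, lintegral_jump hC (measurable_one.indicator hE)]
  refine lintegral_eq_zero_of_ae_eq_zero ?_
  have hm' : ∀ᵐ x ∂m, x ∈ stateSpace μ := hm
  filter_upwards [hm'] with x hx
  refine lintegral_eq_zero_of_ae_eq_zero ?_
  filter_upwards [ae_mem_stateSpace (μ := μ)] with z hz
  by_cases hp : (x, x + z) ∈ C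
  · rw [Set.indicator_of_mem hp]
    exact Set.indicator_of_notMem (show x + z ∉ ((stateSpace μ : Set ℝ) ∩ A)ᶜ from
      fun h => h ⟨add_mem hx hz, hCA _ hp⟩) _
  · rw [Set.indicator_of_notMem hp]
    rfl

lemma occupation_compl_eq_zero (hC : MeasurableSet C) {ν : Measure ℝ}
    (hν : ν (stateSpace μ : Set ℝ)ᶜ = 0) : occupation μ C ν (stateSpace μ : Set ℝ)ᶜ = 0 := by
  rw [occupation, Measure.sum_apply _ measurableSet_stateSpace.compl, ENNReal.tsum_eq_zero]
  intro k
  induction k with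
  | zero => exact hν
  | succ k ih =>
    rw [Function.iterate_succ_apply']
    simpa using jump_compl_eq_zero (A := Set.univ) MeasurableSet.univ hC.compl (by simp) ih

lemma lintegral_step (hC : MeasurableSet C) {f : ℝ → ℝ≥0∞} (hf : Measurable f) (m : Measure ℝ) :
    ∫⁻ x, ∫⁻ z, f (x + z) ∂μ ∂m = ∫⁻ x, jumpOp μ C f x ∂m + ∫⁻ x, jumpOp μ Cᶜ f x ∂m := by
  rw [← lintegral_add_left (measurable_jumpOp hC hf)]
  simp only [jumpOp_add_compl hC hf]

/-- The walk has no jump in `C` before time `n` with probability `(jumpOp μ Cᶜ)^[n] 1`. -/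
lemma jumpOp_iterate_one (hC : MeasurableSet C) (n : ℕ) (x : ℝ) :
    (jumpOp μ Cᶜ)^[n] 1 x = walkLaw μ x {s | ∀ k < n, (s k, s (k + 1)) ∉ C} := by
  have hm (n : ℕ) : MeasurableSet {s : ℕ → ℝ | ∀ k < n, (s k, s (k + 1)) ∉ C} := by
    have heq : {s : ℕ → ℝ | ∀ k < n, (s k, s (k + 1)) ∉ C} =
        ⋂ k ∈ Set.Iio n, (fun s : ℕ → ℝ => (s k, s (k + 1))) ⁻¹' Cᶜ := by
      ext s; simp
    rw [heq]
    refine MeasurableSet.biInter (Set.to_countable _) fun k _ => ?_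
    have : Measurable fun s : ℕ → ℝ => (s k, s (k + 1)) := by fun_prop
    exact this hC.compl
  induction n generalizing x with
  | zero => simp
  | succ n ih =>
    rw [Function.iterate_succ_apply', walkLaw_eq_lintegral (hm (n + 1))]
    refine lintegral_congr fun z => ?_
    by_cases hp : (x, x + z) ∈ C
    · rw [Set.indicator_of_notMem (show (x, x + z) ∉ Cᶜ from fun h => h hp)]
      symm
      refine measure_mono_null ?_ (ae_walkLaw_zero (μ := μ) (x + z))
      intro s (hs : ∀ k < n + 1, _) (h0 : s 0 = x + z)
      have := hs 0 (Nat.succ_pos n)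
      simp only [prepend_zero, zero_add, prepend_succ, h0] at this
      exact this hp
    · rw [Set.indicator_of_mem (show (x, x + z) ∈ Cᶜ from hp)]
      rw [ih]
      refine measure_congr ?_
      filter_upwards [ae_walkLaw_zero (μ := μ) (x + z)] with s h0
      refine propext ⟨fun (hs : ∀ k < n, _) k hk => ?_, fun hs k hk => ?_⟩
      · cases k with
        | zero => simpa only [prepend_zero, zero_add, prepend_succ, h0] using hp
        | succ k => exact hs k (by omega)
      · exact hs (k + 1) (by omega)

lemma tendsto_jumpOp_iterate_one (hC : MeasurableSet C) {x : ℝ}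
    (hx : ∀ᵐ s ∂walkLaw μ x, ∃ n, (s n, s (n + 1)) ∈ C) :
    Tendsto (fun n => (jumpOp μ Cᶜ)^[n] 1 x) atTop (𝓝 0) := by
  simp only [jumpOp_iterate_one hC]
  have h0 : walkLaw μ x (⋂ n, {s : ℕ → ℝ | ∀ k < n, (s k, s (k + 1)) ∉ C}) = 0 := by
    refine measure_mono_null (fun s hs => ?_) hx
    rintro ⟨n, hn⟩
    exact Set.mem_iInter.1 hs (n + 1) n (Nat.lt_succ_self n) hn
  rw [← h0]
  refine tendsto_measure_iInter_atTop (fun n => ?_) ?_ ⟨0, measure_ne_top _ _⟩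
  · have heq : {s : ℕ → ℝ | ∀ k < n, (s k, s (k + 1)) ∉ C} =
        ⋂ k ∈ Set.Iio n, (fun s : ℕ → ℝ => (s k, s (k + 1))) ⁻¹' Cᶜ := by
      ext s; simp
    rw [heq]
    refine (MeasurableSet.biInter (Set.to_countable _) fun k _ => ?_).nullMeasurableSet
    have : Measurable fun s : ℕ → ℝ => (s k, s (k + 1)) := by fun_prop
    exact this hC.compl
  · exact fun m n hmn s hs k hk => hs k (hk.trans_le hmn)

end Jump

/-! ### Chains that list the positions after jumps in `C` -/

section Chain

/-- `F` maps a path to a trajectory that starts at the same point and then lists the positions of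
the path after its jumps in `C`. -/
structure ListsJumps (C : Set (ℝ × ℝ)) (F : (ℕ → ℝ) → MarkovChain.Traj ℝ) : Prop where
  apply_zero : ∀ s, F s 0 = Sum.inl (s 0)
  shift_of_mem : ∀ s, (s 0, s 1) ∈ C → MarkovChain.shift (F s) = F (tail s)
  shift_of_notMem : ∀ s, (s 0, s 1) ∉ C →
    MarkovChain.shift (F s) = MarkovChain.shift (F (tail s))

lemma measurable_shift : Measurable (MarkovChain.shift (X := ℝ)) := by
  unfold MarkovChain.shift
  fun_prop

lemma measurableSet_atTime (n : ℕ) {B : Set ℝ} (hB : MeasurableSet B) :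
    MeasurableSet (MarkovChain.atTime n B) :=
  measurable_pi_apply n (measurableSet_inl_image.2 hB)

variable {μ : Measure ℝ} [IsProbabilityMeasure μ] {C : Set (ℝ × ℝ)}
  {F : (ℕ → ℝ) → MarkovChain.Traj ℝ} {hF : Measurable F}

lemma chainLaw_apply {Γ : Set (MarkovChain.Traj ℝ)} (hΓ : MeasurableSet Γ) (x : ℝ) :
    chainLaw μ F hF x Γ = walkLaw μ x (F ⁻¹' Γ) :=
  Measure.map_apply hF hΓ

lemma chainLaw_atTime_zero (hJ : ListsJumps C F) {B : Set ℝ} (hB : MeasurableSet B) (x : ℝ) :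
    chainLaw μ F hF x (MarkovChain.atTime 0 B) = B.indicator 1 x := by
  rw [chainLaw_apply (measurableSet_atTime 0 hB), ← walkLaw_mem_zero (μ := μ) hB]
  congr 1
  ext s
  change F s 0 ∈ Sum.inl '' B ↔ s 0 ∈ B
  rw [hJ.apply_zero, Sum.inl_injective.mem_set_image]

/-- The first-step decomposition of the chain. -/
lemma chainLaw_shift (hJ : ListsJumps C F) (hC : MeasurableSet C)
    {Γ : Set (MarkovChain.Traj ℝ)} (hΓ : MeasurableSet Γ) (x : ℝ) :
    chainLaw μ F hF x (MarkovChain.shift ⁻¹' Γ) =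
      jumpOp μ C (fun y => chainLaw μ F hF y Γ) x +
        jumpOp μ Cᶜ (fun y => chainLaw μ F hF y (MarkovChain.shift ⁻¹' Γ)) x := by
  have hS := measurable_shift hΓ
  have hm : Measurable fun z => C.indicator (fun p => chainLaw μ F hF p.2 Γ) (x, x + z) :=
    Measurable.comp (g := C.indicator fun p : ℝ × ℝ => chainLaw μ F hF p.2 Γ)
      ((((chainLaw μ F hF).measurable_coe hΓ).comp measurable_snd).indicator hC) (by fun_prop)
  rw [chainLaw_apply hS, walkLaw_eq_lintegral (hF hS), jumpOp, jumpOp, ← lintegral_add_left hm]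
  refine lintegral_congr fun z => ?_
  by_cases hp : (x, x + z) ∈ C
  · rw [Set.indicator_of_mem hp, Set.indicator_of_notMem (show (x, x + z) ∉ Cᶜ from fun h => h hp), add_zero,
      chainLaw_apply hΓ]
    refine measure_congr ?_
    filter_upwards [ae_walkLaw_zero (μ := μ) (x + z)] with s h0
    have h := hJ.shift_of_mem (prepend x s) (by simpa only [prepend, h0] using hp)
    rw [tail_prepend] at h
    change (MarkovChain.shift (F (prepend x s)) ∈ Γ) = (F s ∈ Γ)
    rw [h]
  · rw [Set.indicator_of_notMem hp, Set.indicator_of_mem (show (x, x + z) ∈ Cᶜ from hp), zero_add,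
      chainLaw_apply hS]
    refine measure_congr ?_
    filter_upwards [ae_walkLaw_zero (μ := μ) (x + z)] with s h0
    have h := hJ.shift_of_notMem (prepend x s) (by simpa only [prepend, h0] using hp)
    rw [tail_prepend] at h
    change (MarkovChain.shift (F (prepend x s)) ∈ Γ) = (MarkovChain.shift (F s) ∈ Γ)
    rw [h]

/-- Decomposition by the number `k` of steps before the first jump in `C`: the first-step identity
is iterated, and the remainder is at most the probability of no such jump before time `n`, which
tends to `0`. -/
lemma chainLaw_shift_eq_tsum (hJ : ListsJumps C F) (hC : MeasurableSet C) {x : ℝ}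
    (hx : ∀ᵐ s ∂walkLaw μ x, ∃ n, (s n, s (n + 1)) ∈ C)
    {Γ : Set (MarkovChain.Traj ℝ)} (hΓ : MeasurableSet Γ) :
    chainLaw μ F hF x (MarkovChain.shift ⁻¹' Γ) =
      ∑' k, (jumpOp μ Cᶜ)^[k] (jumpOp μ C fun y => chainLaw μ F hF y Γ) x := by
  have hS := measurable_shift hΓ
  set h : ℝ → ℝ≥0∞ := fun y => chainLaw μ F hF y Γ with hh
  set H : ℝ → ℝ≥0∞ := fun y => chainLaw μ F hF y (MarkovChain.shift ⁻¹' Γ) with hH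
  have hhm : Measurable h := (chainLaw μ F hF).measurable_coe hΓ
  have hHm : Measurable H := (chainLaw μ F hF).measurable_coe hS
  set ν : ℕ → Measure ℝ := fun k => (jump μ Cᶜ)^[k] (Measure.dirac x) with hν
  have hdirac {f : ℝ → ℝ≥0∞} (hf : Measurable f) (k : ℕ) :
      ∫⁻ y, f y ∂ν k = (jumpOp μ Cᶜ)^[k] f x := by
    rw [lintegral_jump_iterate hC.compl _ k hf,
      lintegral_dirac' _ (measurable_jumpOp_iterate hC.compl hf k)]
  have hstep (k : ℕ) :
      ∫⁻ y, H y ∂ν k = ∫⁻ y, jumpOp μ C h y ∂ν k + ∫⁻ y, H y ∂ν (k + 1) := by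
    simp only [hν]
    rw [Function.iterate_succ_apply', lintegral_jump hC.compl hHm,
      ← lintegral_add_left (measurable_jumpOp hC hhm)]
    exact lintegral_congr fun y => chainLaw_shift hJ hC hΓ y
  have hsum (n : ℕ) : H x =
      ∑ k ∈ Finset.range n, (jumpOp μ Cᶜ)^[k] (jumpOp μ C h) x + ∫⁻ y, H y ∂ν n := by
    induction n with
    | zero => rw [hdirac hHm]; simp
    | succ n ih =>
      rw [ih, hstep, Finset.sum_range_succ, hdirac (measurable_jumpOp hC hhm), add_assoc]
  have hzero : Tendsto (fun n => ∫⁻ y, H y ∂ν n) atTop (𝓝 0) := by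
    refine tendsto_of_tendsto_of_tendsto_of_le_of_le tendsto_const_nhds
      (tendsto_jumpOp_iterate_one hC hx) (fun _ => zero_le) fun n => ?_
    rw [← hdirac measurable_one]
    refine lintegral_mono fun y => ?_
    simp only [hH]
    rw [chainLaw_apply hS]
    exact prob_le_one
  have hlim := (ENNReal.tendsto_nat_tsum
    fun k => (jumpOp μ Cᶜ)^[k] (jumpOp μ C h) x).add hzero
  rw [add_zero] at hlim
  exact tendsto_nhds_unique (tendsto_const_nhds.congr hsum) hlim

/-- The law of the chain at time `1`, and of its future from then on. -/
theorem lintegral_chainLaw_shift (hJ : ListsJumps C F) (hC : MeasurableSet C)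
    (hrecur : ∀ x ∈ stateSpace μ, ∀ᵐ s ∂walkLaw μ x, ∃ n, (s n, s (n + 1)) ∈ C)
    {ν : Measure ℝ} (hν : ν (stateSpace μ : Set ℝ)ᶜ = 0)
    {Γ : Set (MarkovChain.Traj ℝ)} (hΓ : MeasurableSet Γ) :
    ∫⁻ x, chainLaw μ F hF x (MarkovChain.shift ⁻¹' Γ) ∂ν =
      ∫⁻ x, chainLaw μ F hF x Γ ∂jump μ C (occupation μ C ν) := by
  have hν' : ∀ᵐ x ∂ν, x ∈ stateSpace μ := hν
  have hhm : Measurable fun y => chainLaw μ F hF y Γ := (chainLaw μ F hF).measurable_coe hΓ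
  have hRm := measurable_jumpOp (μ := μ) hC hhm
  rw [lintegral_jump hC hhm, occupation, lintegral_sum_measure]
  simp only [lintegral_jump_iterate hC.compl ν _ hRm]
  rw [← lintegral_tsum fun k => (measurable_jumpOp_iterate hC.compl hRm k).aemeasurable]
  refine lintegral_congr_ae ?_
  filter_upwards [hν'] with x hx
  exact chainLaw_shift_eq_tsum hJ hC (hrecur x hx) hΓ

lemma lintegral_chainLaw_atTime_one (hJ : ListsJumps C F) (hC : MeasurableSet C)
    (hrecur : ∀ x ∈ stateSpace μ, ∀ᵐ s ∂walkLaw μ x, ∃ n, (s n, s (n + 1)) ∈ C)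
    {ν : Measure ℝ} (hν : ν (stateSpace μ : Set ℝ)ᶜ = 0) {B : Set ℝ} (hB : MeasurableSet B) :
    ∫⁻ x, chainLaw μ F hF x (MarkovChain.atTime 1 B) ∂ν = jump μ C (occupation μ C ν) B := by
  have h := lintegral_chainLaw_shift (hF := hF) hJ hC hrecur hν (measurableSet_atTime 0 hB)
  simp only [chainLaw_atTime_zero hJ hB, lintegral_indicator_one hB] at h
  exact h

/-- Invariance tests only subsets of `E`, but both measures vanish outside `E`, so it becomes an
equality of measures on `ℝ`. -/
lemma isInvariant_iff (hJ : ListsJumps C F) (hC : MeasurableSet C) {A : Set ℝ}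
    (hA : MeasurableSet A) (hCA : ∀ p ∈ C, p.2 ∈ A)
    (hrecur : ∀ x ∈ stateSpace μ, ∀ᵐ s ∂walkLaw μ x, ∃ n, (s n, s (n + 1)) ∈ C)
    {ν : Measure ℝ} (hν : ν (stateSpace μ : Set ℝ)ᶜ = 0) :
    MarkovChain.IsInvariant (chainLaw μ F hF) ((stateSpace μ : Set ℝ) ∩ A) ν ↔
      jump μ C (occupation μ C ν) = ν := by
  have hE : MeasurableSet ((stateSpace μ : Set ℝ) ∩ A) := measurableSet_stateSpace.inter hA
  have h0 := jump_compl_eq_zero hA hC hCA (occupation_compl_eq_zero hC hν)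
  constructor
  · rintro ⟨hνE, h⟩
    ext B hB
    have h1 := h _ (hB.inter hE) Set.inter_subset_right
    rw [lintegral_chainLaw_atTime_one hJ hC hrecur hν (hB.inter hE)] at h1
    rwa [measure_inter_conull h0, measure_inter_conull hνE] at h1
  · intro h
    refine ⟨by rw [← h]; exact h0, fun B hB _ => ?_⟩
    rw [lintegral_chainLaw_atTime_one hJ hC hrecur hν hB, h]

end Chain

/-! ### Invariance, uniqueness, ergodicity and recurrence of the entrance measure -/

variable {μ : Measure ℝ} [IsProbabilityMeasure μ] {C : Set (ℝ × ℝ)}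
  {lam : Measure (stateSpace μ)} [lam.IsAddHaarMeasure]

lemma jump_onReal_le (hC : MeasurableSet C) : jump μ C (onReal lam) ≤ onReal lam := by
  refine Measure.le_iff.2 fun B hB => ?_
  have hB1 : Measurable (B.indicator (1 : ℝ → ℝ≥0∞)) := measurable_one.indicator hB
  rw [← lintegral_indicator_one hB, ← lintegral_indicator_one hB, lintegral_jump hC hB1,
    ← lintegral_step_onReal lam hB1, lintegral_step hC hB1]
  exact le_self_add

/-- Iterating `λ = λ P_C + λ P_{Cᶜ}` gives `λ = ∑_{k<n} λ P_C P_{Cᶜ}ᵏ + λ P_{Cᶜ}ⁿ`, so every partial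
sum of the occupation series is at most `λ`. -/
lemma lintegral_occupation_jump_onReal_le (hC : MeasurableSet C) {f : ℝ → ℝ≥0∞}
    (hf : Measurable f) :
    ∫⁻ x, f x ∂occupation μ C (jump μ C (onReal lam)) ≤ ∫⁻ x, f x ∂onReal lam := by
  rw [occupation, lintegral_sum_measure]
  refine ENNReal.tsum_le_of_sum_range_le fun n => ?_
  induction n generalizing f with
  | zero => simp
  | succ n ih =>
    rw [Finset.sum_range_succ', Function.iterate_zero_apply, lintegral_jump hC hf,
      ← lintegral_step_onReal lam hf, lintegral_step hC hf, add_comm]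
    refine add_le_add_right ?_ _
    simp only [Function.iterate_succ_apply', lintegral_jump hC.compl hf]
    exact ih (measurable_jumpOp hC.compl hf)

/-- Since `m ≤ λ`, one has `m P = m P_C + m P_{Cᶜ} ≤ λ P_C + m P_{Cᶜ} = m`, so `m` is excessive and
rigidity applies. -/
lemma exists_occupation_eq_smul (hrec : TopologicallyRecurrent μ) (hC : MeasurableSet C) :
    ∃ c : ℝ≥0, occupation μ C (jump μ C (onReal lam)) = c • onReal lam := by
  set m := occupation μ C (jump μ C (onReal lam)) with hm
  have hle : m ≤ onReal lam := by
    refine Measure.le_iff.2 fun B hB => ?_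
    rw [← lintegral_indicator_one hB, ← lintegral_indicator_one hB]
    exact lintegral_occupation_jump_onReal_le hC (measurable_one.indicator hB)
  have : IsLocallyFiniteMeasure m := Measure.isLocallyFiniteMeasure_of_le hle
  refine eq_smul_onReal_of_excessive hrec
    (le_antisymm ((hle _).trans (onReal_compl lam).le) zero_le) fun f hf => ?_
  rw [lintegral_step hC hf, hm, lintegral_occupation hC hf (jump μ C (onReal lam)),
    lintegral_jump hC hf, ← hm]
  exact add_le_add_left (lintegral_mono' hle le_rfl) _

/-- The entrance measure of the stationary walk is invariant. -/
theorem jump_occupation_jump_onReal (hrec : TopologicallyRecurrent μ) (hC : MeasurableSet C) :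
    jump μ C (occupation μ C (jump μ C (onReal lam))) = jump μ C (onReal lam) := by
  obtain ⟨c, hc⟩ := exists_occupation_eq_smul (lam := lam) hrec hC
  set m := occupation μ C (jump μ C (onReal lam)) with hm
  have : IsLocallyFiniteMeasure (jump μ C (onReal lam)) :=
    Measure.isLocallyFiniteMeasure_of_le (jump_onReal_le hC)
  symm
  refine Real.measure_ext_Ioo_rat fun a b => ?_
  have hf : Measurable ((Set.Ioo (a : ℝ) b).indicator (1 : ℝ → ℝ≥0∞)) :=
    measurable_one.indicator measurableSet_Ioo
  rw [← lintegral_indicator_one measurableSet_Ioo, ← lintegral_indicator_one measurableSet_Ioo,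
    lintegral_jump hC hf m]
  have h1 := lintegral_occupation (μ := μ) hC hf (jump μ C (onReal lam))
  rw [← hm] at h1
  -- As a multiple of `λ`, `m` is invariant for the walk. Comparing `m = m P_C + m P_{Cᶜ}` with `h1`
  -- leaves the claim after cancelling `m P_{Cᶜ}`, which is finite on bounded intervals.
  have h2 : ∫⁻ x, (Set.Ioo (a : ℝ) b).indicator 1 x ∂m =
      ∫⁻ x, jumpOp μ C ((Set.Ioo (a : ℝ) b).indicator 1) x ∂m +
        ∫⁻ x, jumpOp μ Cᶜ ((Set.Ioo (a : ℝ) b).indicator 1) x ∂m := by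
    rw [← lintegral_step (μ := μ) hC hf, hc, lintegral_smul_measure, lintegral_smul_measure,
      lintegral_step_onReal lam hf]
  have hfin : ∫⁻ x, jumpOp μ Cᶜ ((Set.Ioo (a : ℝ) b).indicator 1) x ∂m ≠ ∞ := by
    refine ne_top_of_le_ne_top ?_ (le_add_self.trans_eq h2.symm)
    rw [lintegral_indicator_one measurableSet_Ioo, hc]
    exact ((measure_mono Set.Ioo_subset_Icc_self).trans_lt
      (isCompact_Icc (a := (a : ℝ)) (b := b)).measure_lt_top).ne
  exact (ENNReal.add_left_inj hfin).1 (h1.symm.trans h2)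

/-- An invariant measure of the walk that is finite on some open set meeting the state space is
locally finite. -/
lemma isLocallyFiniteMeasure_of_invariant (hrec : TopologicallyRecurrent μ) {m : Measure ℝ}
    (hm : m (stateSpace μ : Set ℝ)ᶜ = 0)
    (hinv : ∀ f : ℝ → ℝ≥0∞, Measurable f → ∫⁻ x, ∫⁻ z, f (x + z) ∂μ ∂m = ∫⁻ x, f x ∂m)
    {G : Set ℝ} (hG : IsOpen G) {y : ℝ} (hy : y ∈ stateSpace μ) (hyG : y ∈ G) (hGm : m G < ∞) :
    IsLocallyFiniteMeasure m := by
  refine ⟨fun x => ?_⟩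
  by_cases hx : x ∈ stateSpace μ
  swap
  · exact ⟨_, isClosed_stateSpace.isOpen_compl.mem_nhds hx, by rw [hm]; exact ENNReal.zero_lt_top⟩
  obtain ⟨ε, hε, hεG⟩ := Metric.isOpen_iff.1 hG y hyG
  obtain ⟨n, hn⟩ : ∃ n, walkLaw μ x {s | s n ∈ Metric.ball y (ε / 2)} ≠ 0 := by
    by_contra! hcon
    have h1 : ∀ᵐ s ∂walkLaw μ x, ∀ n, s n ∉ Metric.ball y (ε / 2) :=
      ae_all_iff.2 fun n => measure_eq_zero_iff_ae_notMem.1 (hcon n)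
    obtain ⟨s, hs, hs'⟩ := (h1.and (ae_frequently_mem hrec hx Metric.isOpen_ball hy
      (Metric.mem_ball_self (half_pos hε)))).exists
    obtain ⟨n, hn⟩ := hs'.exists
    exact hs n hn
  refine ⟨Metric.ball x (ε / 2), Metric.ball_mem_nhds x (half_pos hε), ?_⟩
  set δ := walkLaw μ x {s | s n ∈ Metric.ball y (ε / 2)} with hδ
  have hSG : MeasurableSet {s : ℕ → ℝ | s n ∈ G} := measurable_pi_apply n hG.measurableSet
  -- A path from `w` is a path from `x` moved by less than `ε / 2`, which takes the ball of radius
  -- `ε / 2` about `y` into `G`. Thus one `δ` serves all `w` near `x`.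
  have hle (w : ℝ) (hw : w ∈ Metric.ball x (ε / 2)) : δ ≤ walkLaw μ w {s | s n ∈ G} := by
    have hmap := walkLaw_add (μ := μ) x (w - x)
    rw [add_sub_cancel] at hmap
    have hadd : Measurable fun (s : ℕ → ℝ) (n : ℕ) => s n + (w - x) := by fun_prop
    rw [hmap, Measure.map_apply hadd hSG]
    refine measure_mono fun s hs => hεG ?_
    have hs' : s n ∈ Metric.ball y (ε / 2) := hs
    rw [Metric.mem_ball, Real.dist_eq, abs_lt] at hw hs' ⊢
    constructor <;> linarith [hw.1, hw.2, hs'.1, hs'.2]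
  have hmul : δ * m (Metric.ball x (ε / 2)) ≤ m G := by
    rw [← lintegral_walkLaw_mem hinv hG.measurableSet n, ← lintegral_indicator_const
      measurableSet_ball]
    refine lintegral_mono fun w => ?_
    by_cases hw : w ∈ Metric.ball x (ε / 2)
    · rw [Set.indicator_of_mem hw]; exact hle w hw
    · rw [Set.indicator_of_notMem hw]; exact zero_le
  by_contra htop
  rw [not_lt, top_le_iff] at htop
  rw [htop, ENNReal.mul_top hn, top_le_iff] at hmul
  exact hGm.ne hmul

/-- From all points of the state space in some open set, the walk makes a jump in `C` to a fixed
compact subset of `E` with probability bounded away from zero. -/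
def HasUniformJump (μ : Measure ℝ) (C : Set (ℝ × ℝ)) (E : Set ℝ) : Prop :=
  ∃ y ∈ stateSpace μ, ∃ G : Set ℝ, IsOpen G ∧ y ∈ G ∧ ∃ K : Set ℝ, IsCompact K ∧ K ⊆ E ∧
    ∃ δ : ℝ≥0∞, δ ≠ 0 ∧ ∀ x ∈ G, x ∈ stateSpace μ → δ ≤ jumpOp μ C (K.indicator 1) x

lemma HasUniformJump.exists_mul_le {E : Set ℝ} (h : HasUniformJump μ C E) (hC : MeasurableSet C) :
    ∃ y ∈ stateSpace μ, ∃ G : Set ℝ, IsOpen G ∧ y ∈ G ∧ ∃ K : Set ℝ, IsCompact K ∧ K ⊆ E ∧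
      ∃ δ : ℝ≥0∞, δ ≠ 0 ∧ ∀ m : Measure ℝ, m (stateSpace μ : Set ℝ)ᶜ = 0 →
        δ * m G ≤ jump μ C m K := by
  obtain ⟨y, hy, G, hG, hyG, K, hK, hKE, δ, hδ, h⟩ := h
  refine ⟨y, hy, G, hG, hyG, K, hK, hKE, δ, hδ, fun m hm => ?_⟩
  have hm' : ∀ᵐ x ∂m, x ∈ stateSpace μ := hm
  rw [← lintegral_indicator_one hK.measurableSet,
    lintegral_jump hC (measurable_one.indicator hK.measurableSet),
    ← lintegral_indicator_const hG.measurableSet]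
  refine lintegral_mono_ae ?_
  filter_upwards [hm'] with x hx
  by_cases hxG : x ∈ G
  · rw [Set.indicator_of_mem hxG]; exact h x hxG hx
  · rw [Set.indicator_of_notMem hxG]; exact zero_le

variable {F : (ℕ → ℝ) → MarkovChain.Traj ℝ} {hF : Measurable F} {A : Set ℝ}

theorem isInvariant_jump_onReal (hrec : TopologicallyRecurrent μ) (hJ : ListsJumps C F)
    (hC : MeasurableSet C) (hA : MeasurableSet A) (hCA : ∀ p ∈ C, p.2 ∈ A)
    (hrecur : ∀ x ∈ stateSpace μ, ∀ᵐ s ∂walkLaw μ x, ∃ n, (s n, s (n + 1)) ∈ C) :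
    MarkovChain.IsInvariant (chainLaw μ F hF) ((stateSpace μ : Set ℝ) ∩ A)
      (jump μ C (onReal lam)) :=
  (isInvariant_iff hJ hC hA hCA hrecur
    (le_antisymm ((jump_onReal_le hC _).trans (onReal_compl lam).le) zero_le)).2
    (jump_occupation_jump_onReal hrec hC)

/-- The occupation measure `m` of an invariant `ν` is invariant for the walk. The uniform jump
bounds `m G` by a multiple of `ν K`, which is finite as `K` is a compact subset of the state space
of the chain. So `m` is locally finite, hence `c λ`, and `ν = m P_C`. -/
theorem isUniquelyInvariant_jump_onReal (hrec : TopologicallyRecurrent μ) (hJ : ListsJumps C F)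
    (hC : MeasurableSet C) (hA : MeasurableSet A) (hCA : ∀ p ∈ C, p.2 ∈ A)
    (hrecur : ∀ x ∈ stateSpace μ, ∀ᵐ s ∂walkLaw μ x, ∃ n, (s n, s (n + 1)) ∈ C)
    (hunif : HasUniformJump μ C ((stateSpace μ : Set ℝ) ∩ A)) :
    MarkovChain.IsUniquelyInvariant (chainLaw μ F hF) ((stateSpace μ : Set ℝ) ∩ A)
      (jump μ C (onReal lam)) := by
  obtain ⟨y, hy, G, hG, hyG, K, hK, hKE, δ, hδ, hδle⟩ := hunif.exists_mul_le hC
  have hfin : IsLocallyFiniteMeasure (jump μ C (onReal lam)) :=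
    Measure.isLocallyFiniteMeasure_of_le (jump_onReal_le hC)
  refine ⟨fun h0 => ?_, isInvariant_jump_onReal hrec hJ hC hA hCA hrecur,
    fun x _ => Measure.finiteAt_nhdsWithin _ x _, fun ν hν hνfin => ?_⟩
  · have h := hδle _ (onReal_compl lam)
    rw [h0, Measure.coe_zero, Pi.zero_apply, nonpos_iff_eq_zero, mul_eq_zero] at h
    exact h.elim hδ (onReal_pos_of_isOpen lam hG hy hyG).ne'
  · have hνZ : ν (stateSpace μ : Set ℝ)ᶜ = 0 :=
      measure_mono_null (Set.compl_subset_compl.2 Set.inter_subset_left) hν.1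
    have hνeq := (isInvariant_iff hJ hC hA hCA hrecur hνZ).1 hν
    set m := occupation μ C ν with hm
    have hmZ : m (stateSpace μ : Set ℝ)ᶜ = 0 := occupation_compl_eq_zero hC hνZ
    -- `m P = m P_C + m P_{Cᶜ} = ν + m P_{Cᶜ} = m`.
    have hinv (f : ℝ → ℝ≥0∞) (hf : Measurable f) :
        ∫⁻ x, ∫⁻ z, f (x + z) ∂μ ∂m = ∫⁻ x, f x ∂m := by
      rw [lintegral_step hC hf, ← lintegral_jump hC hf, hνeq]
      exact (lintegral_occupation hC hf ν).symm
    have hKfin : ν K < ∞ := hK.measure_lt_top_of_nhdsWithin fun x hx =>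
      (hνfin x (hKE hx)).filter_mono (nhdsWithin_mono _ hKE)
    have hGfin : m G < ∞ := by
      have h := hδle m hmZ
      rw [hνeq] at h
      by_contra htop
      rw [not_lt, top_le_iff] at htop
      rw [htop, ENNReal.mul_top hδ, top_le_iff] at h
      exact hKfin.ne h
    have : IsLocallyFiniteMeasure m :=
      isLocallyFiniteMeasure_of_invariant hrec hmZ hinv hG hy hyG hGfin
    obtain ⟨c, hc⟩ := eq_smul_onReal_of_excessive (lam := lam) hrec hmZ fun f hf => (hinv f hf).le
    refine ⟨c, ?_⟩
    rw [← hνeq, hc]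
    ext B hB
    have hB1 : Measurable (B.indicator (1 : ℝ → ℝ≥0∞)) := measurable_one.indicator hB
    rw [Measure.smul_apply, ← lintegral_indicator_one hB, ← lintegral_indicator_one hB,
      lintegral_jump hC hB1, lintegral_jump hC hB1, lintegral_smul_measure]

theorem isErgodic_jump_onReal (hrec : TopologicallyRecurrent μ) (hJ : ListsJumps C F)
    (hC : MeasurableSet C) (hA : MeasurableSet A) (hCA : ∀ p ∈ C, p.2 ∈ A)
    (hrecur : ∀ x ∈ stateSpace μ, ∀ᵐ s ∂walkLaw μ x, ∃ n, (s n, s (n + 1)) ∈ C) :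
    MarkovChain.IsErgodic (chainLaw μ F hF) ((stateSpace μ : Set ℝ) ∩ A)
      (jump μ C (onReal lam)) := by
  set ν := jump μ C (onReal lam) with hν
  have hνL : ν ≤ onReal lam := jump_onReal_le hC
  have hQ : AEMeasurable (chainLaw μ F hF) ν := (chainLaw μ F hF).measurable.aemeasurable
  refine ⟨isInvariant_jump_onReal hrec hJ hC hA hCA hrecur,
    { measurable := measurable_shift, map_eq := ?_, aeconst_set := fun Γ hΓ hinv => ?_ }⟩
  · ext Γ hΓ
    rw [Measure.map_apply measurable_shift hΓ, Measure.bind_apply (measurable_shift hΓ) hQ,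
      Measure.bind_apply hΓ hQ, lintegral_chainLaw_shift hJ hC hrecur
        (le_antisymm ((hνL _).trans (onReal_compl lam).le) zero_le) hΓ,
      jump_occupation_jump_onReal hrec hC]
  -- Dropping the first point of the path either shifts the listed trajectory (a jump in `C`) or
  -- changes only its initial entry; a shift-invariant `Γ` notices neither.
  · have htail : tail ⁻¹' (F ⁻¹' Γ) = F ⁻¹' Γ := by
      ext s
      have hshift (w : MarkovChain.Traj ℝ) : MarkovChain.shift w ∈ Γ ↔ w ∈ Γ := by
        conv_rhs => rw [← hinv]
        rfl
      change F (tail s) ∈ Γ ↔ F s ∈ Γ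
      by_cases hs : (s 0, s 1) ∈ C
      · rw [← hshift (F s), hJ.shift_of_mem s hs]
      · rw [← hshift (F s), hJ.shift_of_notMem s hs, hshift]
    rw [eventuallyConst_set']
    rcases ae_eq_zero_or_one_of_tail_invariant (lam := lam) hrec (hF hΓ) htail with h | h
    · left
      rw [ae_eq_empty, Measure.bind_apply hΓ hQ]
      refine lintegral_eq_zero_of_ae_eq_zero ?_
      filter_upwards [hνL.absolutelyContinuous.ae_le h] with x hx
      rw [chainLaw_apply hΓ, hx]
      rfl
    · right
      rw [ae_eq_univ, Measure.bind_apply hΓ.compl hQ]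
      refine lintegral_eq_zero_of_ae_eq_zero ?_
      filter_upwards [hνL.absolutelyContinuous.ae_le h] with x hx
      rw [chainLaw_apply hΓ.compl]
      exact (prob_compl_eq_zero_iff (hF hΓ)).2 hx

lemma ListsJumps.exists_apply_mem (hJ : ListsJumps C F) {B : Set ℝ} (n : ℕ) :
    ∀ s : ℕ → ℝ, (s n, s (n + 1)) ∈ C → s (n + 1) ∈ B → ∃ k, F s (k + 1) ∈ Sum.inl '' B := by
  induction n with
  | zero =>
    intro s hs hB
    refine ⟨0, s 1, hB, ?_⟩
    have := congrFun (hJ.shift_of_mem s hs) 0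
    rw [hJ.apply_zero] at this
    exact this.symm
  | succ n ih =>
    intro s hs hB
    obtain ⟨k, hk⟩ := ih (tail s) hs hB
    by_cases h : (s 0, s 1) ∈ C
    · refine ⟨k + 1, ?_⟩
      have := congrFun (hJ.shift_of_mem s h) (k + 1)
      rw [MarkovChain.shift] at this
      rwa [this]
    · refine ⟨k, ?_⟩
      have := congrFun (hJ.shift_of_notMem s h) k
      rw [MarkovChain.shift, MarkovChain.shift] at this
      rwa [this]

/-- Let `V` be the event of some jump in `C` landing in `B`, and `W` that of infinitely many. The
probability of `V` is excessive, so a.e. constant, and it equals that of `W`, which is `0` or `1`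
because `W` is shift-invariant. The value `0` would already exclude such a jump at the first step,
against `hpos`. -/
lemma ae_walkLaw_exists_jump_mem (hrec : TopologicallyRecurrent μ) (hC : MeasurableSet C)
    {B : Set ℝ} (hB : MeasurableSet B) (hpos : jump μ C (onReal lam) B ≠ 0) :
    ∀ᵐ x ∂onReal lam, ∀ᵐ s ∂walkLaw μ x, ∃ n, (s n, s (n + 1)) ∈ C ∧ s (n + 1) ∈ B := by
  set D : ℕ → Set (ℕ → ℝ) := fun n => {s | (s n, s (n + 1)) ∈ C ∧ s (n + 1) ∈ B} with hD
  have hDm (n : ℕ) : MeasurableSet (D n) := by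
    have h1 : Measurable fun s : ℕ → ℝ => (s n, s (n + 1)) := by fun_prop
    exact (h1 hC).inter (measurable_pi_apply (n + 1) hB)
  set V : Set (ℕ → ℝ) := ⋃ n, D n with hV
  have hVm : MeasurableSet V := MeasurableSet.iUnion hDm
  have hVtail (s : ℕ → ℝ) (hs : tail s ∈ V) : s ∈ V := by
    obtain ⟨n, hn⟩ := Set.mem_iUnion.1 hs
    exact Set.mem_iUnion.2 ⟨n + 1, hn⟩
  obtain ⟨c, hc⟩ := ae_eq_const_of_excessive (lam := lam) hrec (measurable_walkLaw_apply hVm)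
    (fun _ => prob_le_one) fun x _ => by
      rw [← walkLaw_tail_preimage hVm]
      exact measure_mono hVtail
  have hVn (n : ℕ) : MeasurableSet (tail^[n] ⁻¹' V) := (measurable_tail.iterate n) hVm
  set W : Set (ℕ → ℝ) := ⋂ n, tail^[n] ⁻¹' V with hW
  have hanti : Antitone fun n => tail^[n] ⁻¹' V := by
    refine antitone_nat_of_succ_le fun n s hs => ?_
    have hs' : tail^[n + 1] s ∈ V := hs
    rw [Function.iterate_succ_apply'] at hs'
    exact hVtail _ hs'
  have hWm : MeasurableSet W := MeasurableSet.iInter hVn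
  have hWtail : tail ⁻¹' W = W := by
    ext s
    simp only [hW, Set.mem_preimage, Set.mem_iInter, ← Function.iterate_succ_apply]
    exact ⟨fun h n => hanti (Nat.le_succ n) (h n), fun h n => h (n + 1)⟩
  have hWc : ∀ᵐ x ∂onReal lam, walkLaw μ x W = c := by
    filter_upwards [ae_walkLaw_forall_of_ae_onReal hc] with x hx
    -- By the Markov property at time `n`, the probability of `V` after `n` shifts is the mean of
    -- the constant `c` over the position at time `n`; `W` is the decreasing limit of these events.
    have hn (n : ℕ) : walkLaw μ x (tail^[n] ⁻¹' V) = c := by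
      have h := lintegral_walkLaw_mul (μ := μ) n (g := 1) (f := V.indicator 1) measurable_one
        (measurable_one.indicator hVm) (fun _ _ _ => rfl) x
      simp only [Pi.one_apply, one_mul, lintegral_indicator_one hVm] at h
      have h2 : ∫⁻ s, walkLaw μ (s n) V ∂walkLaw μ x = ∫⁻ _, c ∂walkLaw μ x :=
        lintegral_congr_ae (by filter_upwards [hx] with s hs using hs n)
      rw [h2, lintegral_const, measure_univ, mul_one] at h
      rw [← h, ← lintegral_indicator_one (hVn n)]
      rfl
    refine tendsto_nhds_unique (tendsto_measure_iInter_atTop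
      (fun n => (hVn n).nullMeasurableSet) hanti ⟨0, measure_ne_top _ _⟩) ?_
    exact tendsto_const_nhds.congr fun n => (hn n).symm
  rcases ae_eq_zero_or_one_of_tail_invariant (lam := lam) hrec hWm hWtail with h | h
  · exfalso
    refine hpos ?_
    rw [← lintegral_indicator_one hB, lintegral_jump hC (measurable_one.indicator hB)]
    refine lintegral_eq_zero_of_ae_eq_zero ?_
    filter_upwards [h, hc, hWc] with x h0 hc hWc
    have hD0 : walkLaw μ x (D 0) = 0 :=
      measure_mono_null (Set.subset_iUnion D 0) (by rw [hc, ← hWc, h0])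
    rw [walkLaw_eq_lintegral (hDm 0)] at hD0
    rw [Pi.zero_apply, ← hD0]
    refine lintegral_congr fun z => ?_
    have hpre : prepend x ⁻¹' D 0 = {s | (x, s 0) ∈ C ∧ s 0 ∈ B} := rfl
    have hset : MeasurableSet {w : ℝ | (x, w) ∈ C ∧ w ∈ B} :=
      (measurable_prodMk_left hC).inter hB
    have := walkLaw_mem_zero (μ := μ) hset (x + z)
    rw [hpre]
    refine Eq.trans ?_ this.symm
    classical
    by_cases h1 : (x, x + z) ∈ C <;> by_cases h2 : x + z ∈ B <;>
      simp [h1, h2]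
  · filter_upwards [h, hc, hWc] with x h1 hc hWc
    have hV1 : walkLaw μ x V = 1 := by rw [hc, ← hWc, h1]
    filter_upwards [(mem_ae_iff_prob_eq_one hVm).2 hV1] with s hs
    exact Set.mem_iUnion.1 hs

theorem isRecurrent_jump_onReal (hrec : TopologicallyRecurrent μ) (hJ : ListsJumps C F)
    (hC : MeasurableSet C) (hA : MeasurableSet A) (hCA : ∀ p ∈ C, p.2 ∈ A)
    (hrecur : ∀ x ∈ stateSpace μ, ∀ᵐ s ∂walkLaw μ x, ∃ n, (s n, s (n + 1)) ∈ C) :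
    MarkovChain.IsRecurrent (chainLaw μ F hF) ((stateSpace μ : Set ℝ) ∩ A)
      (jump μ C (onReal lam)) := by
  refine ⟨isInvariant_jump_onReal hrec hJ hC hA hCA hrecur, fun B hB _ _ => ?_⟩
  by_cases hpos : jump μ C (onReal lam) B = 0
  · filter_upwards [measure_eq_zero_iff_ae_notMem.1 hpos] with x hx hxB
    exact absurd hxB hx
  · filter_upwards [(jump_onReal_le (lam := lam) hC).absolutelyContinuous.ae_le
      (ae_walkLaw_exists_jump_mem hrec hC hB hpos)] with x hx _
    have hm : MeasurableSet (⋃ n : ℕ, MarkovChain.atTime (n + 1) B) :=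
      MeasurableSet.iUnion fun n => measurableSet_atTime (n + 1) hB
    rw [chainLaw_apply hm]
    refine (mem_ae_iff_prob_eq_one (hF hm)).1 ?_
    filter_upwards [hx] with s ⟨n, hn, hnB⟩
    obtain ⟨k, hk⟩ := hJ.exists_apply_mem n s hn hnB
    exact Set.mem_iUnion.2 ⟨k, hk⟩

/-! ### Overshoots as lists of crossing jumps -/

section Crossing

/-- The up-crossing jumps of the zero level. -/
def upJumps : Set (ℝ × ℝ) := {p | p.1 < 0 ∧ 0 ≤ p.2}

/-- The down-crossing jumps of the zero level. -/
def downJumps : Set (ℝ × ℝ) := {p | 0 ≤ p.1 ∧ p.2 < 0}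

lemma measurableSet_upJumps : MeasurableSet upJumps :=
  (measurableSet_lt measurable_fst measurable_const).inter
    (measurableSet_le measurable_const measurable_snd)

lemma measurableSet_downJumps : MeasurableSet downJumps :=
  (measurableSet_le measurable_const measurable_fst).inter
    (measurableSet_lt measurable_snd measurable_const)

lemma mem_upJumps {x y : ℝ} : (x, y) ∈ upJumps ↔ x < 0 ∧ 0 ≤ y := Iff.rfl

lemma mem_downJumps {x y : ℝ} : (x, y) ∈ downJumps ↔ 0 ≤ x ∧ y < 0 := Iff.rfl

lemma isCrossing_one {s : ℕ → ℝ} : IsCrossing s 1 ↔ (s 0, s 1) ∈ upJumps ∪ downJumps := by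
  simp [IsCrossing, mem_upJumps, mem_downJumps]

lemma isCrossing_tail {s : ℕ → ℝ} {k : ℕ} (hk : 1 ≤ k) :
    IsCrossing (tail s) k ↔ IsCrossing s (k + 1) := by
  simp only [IsCrossing, tail, Nat.sub_add_cancel hk, Nat.add_sub_cancel]
  simp [hk]

/-- The hypothesis matches the crossings of `s` after `t'` with those of `tail s` after `t`, delayed
by one; the infimum is an attained minimum, or `⊤` on both sides. -/
lemma iInf_crossing_add_one (s : ℕ → ℝ) {t t' : ℕ∞}
    (h : ∀ k : ℕ, (t' < k ∧ IsCrossing s k) ↔ ∃ j : ℕ, k = j + 1 ∧ t < j ∧ IsCrossing s k) :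
    (⨅ k : ℕ, ⨅ _ : t' < k ∧ IsCrossing s k, (k : ℕ∞)) =
      (⨅ k : ℕ, ⨅ _ : t < k ∧ IsCrossing (tail s) k, (k : ℕ∞)) + 1 := by
  have hpos {j : ℕ} (hj : t < j) : 1 ≤ j := by
    rcases Nat.eq_zero_or_pos j with rfl | hj'
    · simp at hj
    · exact hj'
  refine le_antisymm ?_ ?_
  · by_cases hex : ∃ k : ℕ, t < k ∧ IsCrossing (tail s) k
    · classical
      have hmin : (⨅ k : ℕ, ⨅ _ : t < k ∧ IsCrossing (tail s) k, (k : ℕ∞)) = Nat.find hex :=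
        le_antisymm (iInf₂_le (Nat.find hex) (Nat.find_spec hex))
          (le_iInf₂ fun k hk => Nat.cast_le.2 (Nat.find_min' hex hk))
      rw [hmin]
      obtain ⟨h1, h2⟩ := Nat.find_spec hex
      exact iInf₂_le (Nat.find hex + 1) ((h _).2 ⟨_, rfl, h1, (isCrossing_tail (hpos h1)).1 h2⟩)
    · have htop : (⨅ k : ℕ, ⨅ _ : t < k ∧ IsCrossing (tail s) k, (k : ℕ∞)) = ⊤ :=
        iInf₂_eq_top.2 fun k hk => absurd ⟨k, hk⟩ hex
      rw [htop]
      exact le_top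
  · refine le_iInf₂ fun k hk => ?_
    obtain ⟨j, rfl, hj, hs⟩ := (h k).1 hk
    rw [Nat.cast_add, Nat.cast_one]
    exact add_le_add_left (iInf₂_le j ⟨hj, (isCrossing_tail (hpos hj)).2 hs⟩) 1

lemma iInf_crossing_succ (s : ℕ → ℝ) (t : ℕ∞) :
    (⨅ k : ℕ, ⨅ _ : t + 1 < k ∧ IsCrossing s k, (k : ℕ∞)) =
      (⨅ k : ℕ, ⨅ _ : t < k ∧ IsCrossing (tail s) k, (k : ℕ∞)) + 1 := by
  have hlt (j : ℕ) : t + 1 < ((j + 1 : ℕ) : ℕ∞) ↔ t < j := by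
    rw [Nat.cast_add, Nat.cast_one]
    exact ENat.add_lt_add_iff_right (by simp)
  refine iInf_crossing_add_one s fun k => ⟨fun ⟨h1, h2⟩ => ?_, ?_⟩
  · cases k with
    | zero => simp at h1
    | succ j => exact ⟨j, rfl, (hlt j).1 h1, h2⟩
  · rintro ⟨j, rfl, hj, hs⟩
    exact ⟨(hlt j).2 hj, hs⟩

lemma crossingTime_succ_of_crossing {s : ℕ → ℝ} (h : IsCrossing s 1) (n : ℕ) :
    crossingTime s (n + 1) = crossingTime (tail s) n + 1 := by
  induction n with
  | zero =>
    refine le_antisymm (iInf₂_le_of_le 1 ⟨by simp [crossingTime], h⟩ (by simp [crossingTime])) ?_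
    refine le_iInf₂ fun k hk => ?_
    simp only [crossingTime, zero_add] at hk ⊢
    exact Order.one_le_iff_pos.2 hk.1
  | succ n ih =>
    rw [crossingTime, ih]
    exact iInf_crossing_succ s _

lemma crossingTime_succ_of_not_crossing {s : ℕ → ℝ} (h : ¬ IsCrossing s 1) (n : ℕ) :
    crossingTime s (n + 1) = crossingTime (tail s) (n + 1) + 1 := by
  induction n with
  | zero =>
    refine iInf_crossing_add_one s fun k => ⟨fun ⟨h1, h2⟩ => ?_, ?_⟩
    · match k with
      | 0 => simp at h1
      | 1 => exact absurd h2 h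
      | j + 2 => exact ⟨j + 1, rfl, by simp [crossingTime, pos_iff_ne_zero], h2⟩
    · rintro ⟨j, rfl, hj, hs⟩
      exact ⟨by simp [crossingTime, pos_iff_ne_zero], hs⟩
  | succ n ih =>
    rw [crossingTime, ih]
    exact iInf_crossing_succ s _

lemma valueAt_add_one (s : ℕ → ℝ) (t : ℕ∞) : valueAt s (t + 1) = valueAt (tail s) t := by
  induction t using ENat.recTopCoe with
  | top => rfl
  | coe n =>
    have h1 : ((n : ℕ∞) + 1) = ((n + 1 : ℕ) : ℕ∞) := by simp
    rw [h1, valueAt, valueAt, if_neg (ENat.natCast_ne_top _), if_neg (ENat.natCast_ne_top _),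
      ENat.toNat_natCast, ENat.toNat_natCast]
    rfl

lemma overshoot_zero (s : ℕ → ℝ) : overshoot s 0 = Sum.inl (s 0) := by
  simp [overshoot, crossingTime, valueAt]

lemma overshoot_succ_of_crossing {s : ℕ → ℝ} (h : IsCrossing s 1) (n : ℕ) :
    overshoot s (n + 1) = overshoot (tail s) n := by
  rw [overshoot, crossingTime_succ_of_crossing h, valueAt_add_one]
  rfl

lemma overshoot_succ_of_not_crossing {s : ℕ → ℝ} (h : ¬ IsCrossing s 1) (n : ℕ) :
    overshoot s (n + 1) = overshoot (tail s) (n + 1) := by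
  rw [overshoot, crossingTime_succ_of_not_crossing h, valueAt_add_one]
  rfl

lemma listsJumps_overshoot : ListsJumps (upJumps ∪ downJumps) overshoot where
  apply_zero := overshoot_zero
  shift_of_mem _ hs := funext fun n => overshoot_succ_of_crossing (isCrossing_one.2 hs) n
  shift_of_notMem _ hs := funext fun n =>
    overshoot_succ_of_not_crossing (fun h => hs (isCrossing_one.1 h)) n

/-- Bookkeeping of the index `2n - 1(s 0 < 0)`. An up-crossing at time `1` uses up one crossing and
takes `2(n+1) - 1` to `2n`; a down-crossing takes `2(n+1)` to `2(n+1) - 1`; without a crossing the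
sign and the index are unchanged. -/
lemma listsJumps_upOvershoot : ListsJumps upJumps upOvershoot where
  apply_zero s := by simp [upOvershoot, overshoot_zero]
  shift_of_mem s hs := by
    have hc : IsCrossing s 1 := isCrossing_one.2 (Or.inl hs)
    rw [mem_upJumps] at hs
    funext n
    have h : 2 * (n + 1) - 1 = 2 * n + 1 := by omega
    simp only [MarkovChain.shift, upOvershoot, tail_apply, zero_add, hs.1, not_lt.2 hs.2, if_true,
      if_false, h, Nat.sub_zero]
    exact overshoot_succ_of_crossing hc _
  shift_of_notMem s hs := by
    rw [mem_upJumps, not_and, not_le] at hs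
    funext n
    have h : 2 * (n + 1) - 1 = 2 * n + 1 := by omega
    have h' : 2 * (n + 1) - 0 = 2 * n + 1 + 1 := by omega
    simp only [MarkovChain.shift, upOvershoot, tail_apply, zero_add]
    by_cases h0 : s 0 < 0
    · have hc : ¬ IsCrossing s 1 := by
        rw [isCrossing_one, Set.mem_union, mem_upJumps, mem_downJumps]
        have := hs h0
        grind
      simp only [h0, hs h0, if_true, h]
      exact overshoot_succ_of_not_crossing hc _
    · by_cases h1 : s 1 < 0
      · have hc : IsCrossing s 1 := isCrossing_one.2 (Or.inr ⟨not_lt.1 h0, h1⟩)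
        simp only [h0, h1, if_true, if_false, h, h']
        exact overshoot_succ_of_crossing hc _
      · have hc : ¬ IsCrossing s 1 := by
          rw [isCrossing_one, Set.mem_union, mem_upJumps, mem_downJumps]
          grind
        simp only [h0, h1, if_false, h']
        exact overshoot_succ_of_not_crossing hc _

lemma listsJumps_downOvershoot : ListsJumps downJumps downOvershoot where
  apply_zero s := by simp [downOvershoot, overshoot_zero]
  shift_of_mem s hs := by
    have hc : IsCrossing s 1 := isCrossing_one.2 (Or.inr hs)
    rw [mem_downJumps] at hs
    funext n
    have h : 2 * (n + 1) - 1 = 2 * n + 1 := by omega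
    simp only [MarkovChain.shift, downOvershoot, tail_apply, zero_add, hs.1, not_le.2 hs.2, if_true,
      if_false, h, Nat.sub_zero]
    exact overshoot_succ_of_crossing hc _
  shift_of_notMem s hs := by
    rw [mem_downJumps, not_and, not_lt] at hs
    funext n
    have h : 2 * (n + 1) - 1 = 2 * n + 1 := by omega
    have h' : 2 * (n + 1) - 0 = 2 * n + 1 + 1 := by omega
    simp only [MarkovChain.shift, downOvershoot, tail_apply, zero_add]
    by_cases h0 : 0 ≤ s 0
    · have hc : ¬ IsCrossing s 1 := by
        rw [isCrossing_one, Set.mem_union, mem_upJumps, mem_downJumps]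
        have := hs h0
        grind
      simp only [h0, hs h0, if_true, h]
      exact overshoot_succ_of_not_crossing hc _
    · by_cases h1 : 0 ≤ s 1
      · have hc : IsCrossing s 1 := isCrossing_one.2 (Or.inl ⟨not_le.1 h0, h1⟩)
        simp only [h0, h1, if_true, if_false, h, h']
        exact overshoot_succ_of_crossing hc _
      · have hc : ¬ IsCrossing s 1 := by
          rw [isCrossing_one, Set.mem_union, mem_upJumps, mem_downJumps]
          grind
        simp only [h0, h1, if_false, h']
        exact overshoot_succ_of_not_crossing hc _

end Crossing

/-! ### Densities of the entrance measures -/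

section Density

variable {μ : Measure ℝ}

lemma measure_setOf_mem_upJumps (x : ℝ) :
    μ {z | (x - z, x) ∈ upJumps} = (Set.Ici 0).indicator (fun y => μ (Set.Ioi y)) x := by
  by_cases hx : 0 ≤ x
  · rw [Set.indicator_of_mem (Set.mem_Ici.2 hx)]
    congr 1
    ext z
    simp [mem_upJumps, hx]
  · rw [Set.indicator_of_notMem (by simpa using hx)]
    simp [mem_upJumps, hx]

lemma measure_setOf_mem_downJumps (x : ℝ) :
    μ {z | (x - z, x) ∈ downJumps} = (Set.Iio 0).indicator (fun y => μ (Set.Iic y)) x := by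
  by_cases hx : x < 0
  · rw [Set.indicator_of_mem (Set.mem_Iio.2 hx)]
    congr 1
    ext z
    simp [mem_downJumps, hx]
  · rw [Set.indicator_of_notMem (by simpa using hx)]
    simp [mem_downJumps, hx]

variable [IsProbabilityMeasure μ] (lam : Measure (stateSpace μ)) [lam.IsAddHaarMeasure]

/-- For each fixed increment `z` in the state space, this is the invariance of `λ` under translation
by `z`. It exposes the endpoint of a jump as the variable of integration, so the entrance density
can be read off. -/
lemma lintegral_step_reverse {g : ℝ × ℝ → ℝ≥0∞} (hg : Measurable g) :
    ∫⁻ x, ∫⁻ z, g (x, x + z) ∂μ ∂onReal lam = ∫⁻ x, ∫⁻ z, g (x - z, x) ∂μ ∂onReal lam := by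
  rw [lintegral_lintegral_swap (by fun_prop)]
  conv_rhs => rw [lintegral_lintegral_swap (by fun_prop)]
  refine lintegral_congr_ae ?_
  filter_upwards [ae_mem_stateSpace (μ := μ)] with z hz
  rw [← lintegral_add_onReal lam hz (f := fun x => g (x - z, x)) (by fun_prop)]
  simp

lemma jump_onReal_eq_withDensity {C : Set (ℝ × ℝ)} (hC : MeasurableSet C) :
    jump μ C (onReal lam) = (onReal lam).withDensity fun x => μ {z | (x - z, x) ∈ C} := by
  ext B hB
  have hB1 : Measurable (B.indicator (1 : ℝ → ℝ≥0∞)) := measurable_one.indicator hB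
  have hCB : Measurable (C.indicator fun p : ℝ × ℝ => B.indicator (1 : ℝ → ℝ≥0∞) p.2) :=
    (hB1.comp measurable_snd).indicator hC
  rw [← lintegral_indicator_one hB, lintegral_jump hC hB1, withDensity_apply _ hB,
    ← lintegral_indicator hB]
  simp only [jumpOp]
  rw [lintegral_step_reverse lam hCB]
  refine lintegral_congr fun x => ?_
  have hCx : MeasurableSet {z | (x - z, x) ∈ C} := by
    have : Measurable fun z : ℝ => (x - z, x) := by fun_prop
    exact this hC
  by_cases hx : x ∈ B
  · rw [Set.indicator_of_mem hx, ← lintegral_indicator_one hCx]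
    refine lintegral_congr fun z => ?_
    by_cases hp : (x - z, x) ∈ C <;> simp [hp, hx]
  · rw [Set.indicator_of_notMem hx]
    refine lintegral_eq_zero_of_ae_eq_zero (ae_of_all _ fun z => ?_)
    by_cases hp : (x - z, x) ∈ C <;> simp [hp, hx]

lemma jump_upJumps_onReal : jump μ upJumps (onReal lam) = piPlus μ lam := by
  rw [jump_onReal_eq_withDensity lam measurableSet_upJumps, piPlus,
    ← withDensity_indicator measurableSet_Ici]
  congr 1
  funext x
  rw [measure_setOf_mem_upJumps]
  congr 1
  funext y
  rw [← prob_compl_eq_one_sub measurableSet_Iic, Set.compl_Iic]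

lemma jump_downJumps_onReal : jump μ downJumps (onReal lam) = piMinus μ lam := by
  rw [jump_onReal_eq_withDensity lam measurableSet_downJumps, piMinus,
    ← withDensity_indicator measurableSet_Iio]
  congr 1
  funext x
  rw [measure_setOf_mem_downJumps]
  congr 1
  funext y
  rw [← prob_compl_eq_one_sub measurableSet_Ioi, Set.compl_Ioi]

lemma jump_union_onReal : jump μ (upJumps ∪ downJumps) (onReal lam) = piFull μ lam := by
  rw [jump_onReal_eq_withDensity lam (measurableSet_upJumps.union measurableSet_downJumps), piFull]
  congr 1
  funext x
  rw [← measure_setOf_mem_upJumps, ← measure_setOf_mem_downJumps, ← measure_union]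
  · rfl
  · refine Set.disjoint_left.2 fun z h1 h2 => ?_
    exact absurd h1.2 (not_le.2 h2.2)
  · have : Measurable fun z : ℝ => (x - z, x) := by fun_prop
    exact this measurableSet_downJumps

end Density

/-! ### The walk crosses zero in both directions -/

section Nondegenerate

variable {μ : Measure ℝ} [IsProbabilityMeasure μ]

lemma exists_pos_mem_stateSpace (hnondeg : μ ≠ Measure.dirac 0) : ∃ y ∈ stateSpace μ, 0 < y := by
  by_contra! hcon
  refine hnondeg ?_
  have h0 : ∀ᵐ z ∂μ, z = 0 := by
    filter_upwards [ae_mem_stateSpace (μ := μ)] with z hz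
    have := hcon (-z) (neg_mem hz)
    exact le_antisymm (hcon z hz) (by linarith)
  have h1 : μ.map id = μ.map fun _ => (0 : ℝ) := Measure.map_congr h0
  rw [Measure.map_id, Measure.map_const, measure_univ, one_smul] at h1
  exact h1

variable (hrec : TopologicallyRecurrent μ) (hnondeg : μ ≠ Measure.dirac 0)

include hrec hnondeg

lemma ae_frequently_pos {x : ℝ} (hx : x ∈ stateSpace μ) :
    ∀ᵐ s ∂walkLaw μ x, ∃ᶠ n in atTop, 0 < s n := by
  obtain ⟨y, hy, hy0⟩ := exists_pos_mem_stateSpace hnondeg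
  exact ae_frequently_mem hrec hx isOpen_Ioi hy hy0

lemma ae_frequently_neg {x : ℝ} (hx : x ∈ stateSpace μ) :
    ∀ᵐ s ∂walkLaw μ x, ∃ᶠ n in atTop, s n < 0 := by
  obtain ⟨y, hy, hy0⟩ := exists_pos_mem_stateSpace hnondeg
  exact ae_frequently_mem hrec hx isOpen_Iio (neg_mem hy) (Set.mem_Iio.2 (neg_lt_zero.2 hy0))

/-- A path that is negative at some time and never crosses upwards stays negative, yet positive
values recur. -/
lemma ae_exists_upJump {x : ℝ} (hx : x ∈ stateSpace μ) :
    ∀ᵐ s ∂walkLaw μ x, ∃ n, (s n, s (n + 1)) ∈ upJumps := by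
  filter_upwards [ae_frequently_pos hrec hnondeg hx, ae_frequently_neg hrec hnondeg hx]
    with s hpos hneg
  by_contra! hcon
  obtain ⟨n, hn⟩ := hneg.exists
  have hall : ∀ m, n ≤ m → s m < 0 := fun m hm => by
    induction m, hm using Nat.le_induction with
    | base => exact hn
    | succ m _ ih => exact not_le.1 fun h => hcon m ⟨ih, h⟩
  obtain ⟨m, hm, hm0⟩ := frequently_atTop.1 hpos n
  exact lt_asymm hm0 (hall m hm)

lemma ae_exists_downJump {x : ℝ} (hx : x ∈ stateSpace μ) :
    ∀ᵐ s ∂walkLaw μ x, ∃ n, (s n, s (n + 1)) ∈ downJumps := by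
  filter_upwards [ae_frequently_pos hrec hnondeg hx, ae_frequently_neg hrec hnondeg hx]
    with s hpos hneg
  by_contra! hcon
  obtain ⟨n, hn⟩ := hpos.exists
  have hall : ∀ m, n ≤ m → 0 ≤ s m := fun m hm => by
    induction m, hm using Nat.le_induction with
    | base => exact hn.le
    | succ m _ ih => exact not_lt.1 fun h => hcon m ⟨ih, h⟩
  obtain ⟨m, hm, hm0⟩ := frequently_atTop.1 hneg n
  exact absurd (hall m hm) (not_le.2 hm0)

/-- Otherwise the walk from `0` would a.s. never be positive. -/
lemma measure_Ioi_zero_pos : 0 < μ (Set.Ioi 0) := by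
  rw [pos_iff_ne_zero]
  intro h
  have hS : Set.Iic (0 : ℝ) ∈ ae μ := by rwa [mem_ae_iff, Set.compl_Iic]
  have hle : ∀ᵐ s ∂walkLaw μ 0, ∀ n, s n ≤ 0 := ae_walkLaw_of_increments hS fun ξ hξ n => by
    simpa [walkPath] using Finset.sum_nonpos fun i _ => hξ i
  obtain ⟨s, hs, hs'⟩ := (hle.and (ae_frequently_pos hrec hnondeg (zero_mem _))).exists
  obtain ⟨n, hn⟩ := hs'.exists
  exact not_le.2 hn (hs n)

lemma measure_Iio_zero_pos : 0 < μ (Set.Iio 0) := by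
  rw [pos_iff_ne_zero]
  intro h
  have hS : Set.Ici (0 : ℝ) ∈ ae μ := by rwa [mem_ae_iff, Set.compl_Ici]
  have hle : ∀ᵐ s ∂walkLaw μ 0, ∀ n, 0 ≤ s n := ae_walkLaw_of_increments hS fun ξ hξ n => by
    simpa [walkPath] using Finset.sum_nonneg fun i _ => hξ i
  obtain ⟨s, hs, hs'⟩ := (hle.and (ae_frequently_neg hrec hnondeg (zero_mem _))).exists
  obtain ⟨n, hn⟩ := hs'.exists
  exact not_le.2 hn (hs n)

end Nondegenerate

/-! ### Uniform jumps into compact sets -/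

section UniformJump

variable {μ : Measure ℝ}

lemma measure_le_jumpOp {C : Set (ℝ × ℝ)} {S K : Set ℝ} {x : ℝ} (hS : MeasurableSet S)
    (hx : x ∈ stateSpace μ)
    (h : ∀ z ∈ S, x + z ∈ stateSpace μ → (x, x + z) ∈ C ∧ x + z ∈ K) :
    μ S ≤ jumpOp μ C (K.indicator 1) x := by
  rw [← lintegral_indicator_one hS]
  refine lintegral_mono_ae ?_
  filter_upwards [ae_mem_stateSpace (μ := μ)] with z hz
  by_cases hzS : z ∈ S
  · obtain ⟨h1, h2⟩ := h z hzS (add_mem hx hz)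
    rw [Set.indicator_of_mem hzS, Set.indicator_of_mem h1, Set.indicator_of_mem h2]
    rfl
  · rw [Set.indicator_of_notMem hzS]
    exact zero_le

lemma HasUniformJump.mono {C C' : Set (ℝ × ℝ)} {E E' : Set ℝ} (h : HasUniformJump μ C E)
    (hC : C ⊆ C') (hE : E ⊆ E') : HasUniformJump μ C' E' := by
  obtain ⟨y, hy, G, hG, hyG, K, hK, hKE, δ, hδ, h⟩ := h
  refine ⟨y, hy, G, hG, hyG, K, hK, hKE.trans hE, δ, hδ, fun x hx hxZ => (h x hx hxZ).trans ?_⟩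
  exact lintegral_mono fun z => Set.indicator_le_indicator_of_subset hC (fun _ => zero_le) _

lemma exists_measure_Icc_pos_of_Ioi {m : Measure ℝ} (h : 0 < m (Set.Ioi 0)) :
    ∃ c > 0, ∃ M, m (Set.Icc c M) ≠ 0 := by
  by_contra! hcon
  have hsub : Set.Ioi (0 : ℝ) ⊆ ⋃ n : ℕ, ⋃ k : ℕ, Set.Icc (1 / ((n : ℝ) + 1)) k := by
    intro x hx
    obtain ⟨n, hn⟩ := exists_nat_one_div_lt (Set.mem_Ioi.1 hx)
    obtain ⟨k, hk⟩ := exists_nat_ge x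
    exact Set.mem_iUnion₂.2 ⟨n, k, hn.le, hk⟩
  refine h.ne' (measure_mono_null hsub ?_)
  refine measure_iUnion_null fun n => measure_iUnion_null fun k => ?_
  exact hcon _ (by positivity) _

lemma exists_measure_Icc_pos_of_Iio {m : Measure ℝ} (h : 0 < m (Set.Iio 0)) :
    ∃ c > 0, ∃ M, m (Set.Icc (-M) (-c)) ≠ 0 := by
  have hneg : 0 < m.map (fun x => -x) (Set.Ioi 0) := by
    rw [Measure.map_apply measurable_neg measurableSet_Ioi]
    simpa using h
  obtain ⟨c, hc, M, hM⟩ := exists_measure_Icc_pos_of_Ioi hneg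
  refine ⟨c, hc, M, ?_⟩
  rw [Measure.map_apply measurable_neg measurableSet_Icc] at hM
  simpa using hM

lemma eq_of_mem_stateSpace_of_dist_lt {c : ℝ}
    (hc : ∀ y ∈ stateSpace μ, 0 < y → c ≤ y) {x y : ℝ} (hx : x ∈ stateSpace μ)
    (hy : y ∈ stateSpace μ) (hxy : dist x y < c) : x = y := by
  rw [Real.dist_eq, abs_lt] at hxy
  rcases lt_trichotomy x y with h | h | h
  · linarith [hc _ (sub_mem hy hx) (sub_pos.2 h)]
  · exact h
  · linarith [hc _ (sub_mem hx hy) (sub_pos.2 h)]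

/-- Take `[c, M]` with `c > 0` charged by `μ`. If the state space has a positive point below `c`,
every start in `(-c, 0)` followed by an increment in `[c, M]` lands in `[0, M]`. Otherwise distinct
points of the state space are at least `c` apart, and a jump from `-z₀` to `0` with an atom `z₀ > 0`
suffices. -/
lemma hasUniformJump_upJumps (hpos : 0 < μ (Set.Ioi 0)) :
    HasUniformJump μ upJumps ((stateSpace μ : Set ℝ) ∩ Set.Ici 0) := by
  obtain ⟨c, hc, M, hM⟩ := exists_measure_Icc_pos_of_Ioi hpos
  have hK (b : ℝ) : IsCompact ((stateSpace μ : Set ℝ) ∩ Set.Icc 0 b) :=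
    isCompact_Icc.inter_left isClosed_stateSpace
  have hKE (b : ℝ) : (stateSpace μ : Set ℝ) ∩ Set.Icc 0 b ⊆ (stateSpace μ : Set ℝ) ∩ Set.Ici 0 :=
    Set.inter_subset_inter_right _ Set.Icc_subset_Ici_self
  by_cases hex : ∃ y ∈ stateSpace μ, 0 < y ∧ y < c
  · obtain ⟨y, hy, hy0, hyc⟩ := hex
    refine ⟨-y, neg_mem hy, Set.Ioo (-c) 0, isOpen_Ioo, ⟨by linarith, by linarith⟩, _, hK M, hKE M,
      _, hM, fun x hx hxZ => measure_le_jumpOp measurableSet_Icc hxZ fun z hz hxz => ?_⟩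
    obtain ⟨h1, h2⟩ := hx
    obtain ⟨h3, h4⟩ := hz
    exact ⟨⟨h2, by dsimp only; linarith⟩, hxz, by linarith, by linarith⟩
  · push Not at hex
    obtain ⟨z₀, hz₀, hz₀s⟩ := Measure.nonempty_inter_support_of_pos hpos
    have hz₀Z := support_subset_stateSpace hz₀s
    have hball := (Measure.mem_support_iff_forall z₀).1 hz₀s _ (Metric.ball_mem_nhds z₀ hc)
    refine ⟨-z₀, neg_mem hz₀Z, Metric.ball (-z₀) c, Metric.isOpen_ball, Metric.mem_ball_self hc, _,
      hK 0, hKE 0, _, hball.ne', fun x hx hxZ =>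
        measure_le_jumpOp measurableSet_ball hxZ fun z hz hxz => ?_⟩
    have hxe : x = -z₀ := eq_of_mem_stateSpace_of_dist_lt hex hxZ (neg_mem hz₀Z) hx
    have hzZ : z ∈ stateSpace μ := by simpa using sub_mem hxz hxZ
    have hze : z = z₀ := eq_of_mem_stateSpace_of_dist_lt hex hzZ hz₀Z hz
    subst hze
    have h0 : x + z = 0 := by rw [hxe]; ring
    refine ⟨⟨?_, h0.ge⟩, hxz, h0.ge, h0.le⟩
    rw [hxe]
    exact neg_lt_zero.2 hz₀

lemma hasUniformJump_downJumps (hneg : 0 < μ (Set.Iio 0)) :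
    HasUniformJump μ downJumps ((stateSpace μ : Set ℝ) ∩ Set.Iio 0) := by
  obtain ⟨c, hc, M, hM⟩ := exists_measure_Icc_pos_of_Iio hneg
  have hK (a b : ℝ) : IsCompact ((stateSpace μ : Set ℝ) ∩ Set.Icc a b) :=
    isCompact_Icc.inter_left isClosed_stateSpace
  have hKE {a b : ℝ} (hb : b < 0) :
      (stateSpace μ : Set ℝ) ∩ Set.Icc a b ⊆ (stateSpace μ : Set ℝ) ∩ Set.Iio 0 :=
    Set.inter_subset_inter_right _ fun x hx => hx.2.trans_lt hb
  by_cases hex : ∃ y ∈ stateSpace μ, 0 < y ∧ y < c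
  · obtain ⟨y, hy, hy0, hyc⟩ := hex
    -- The target is open at `0`, so a compact subset must stay away from `0`. Starts below the
    -- midpoint `(y + c) / 2 < c` land at or below `(y + c) / 2 - c < 0`.
    refine ⟨y, hy, Set.Ioo 0 ((y + c) / 2), isOpen_Ioo, ⟨hy0, by linarith⟩, _,
      hK (-M) ((y + c) / 2 - c), hKE (by linarith), _, hM, fun x hx hxZ =>
        measure_le_jumpOp measurableSet_Icc hxZ fun z hz hxz => ?_⟩
    obtain ⟨h1, h2⟩ := hx
    obtain ⟨h3, h4⟩ := hz
    exact ⟨⟨h1.le, by dsimp only; linarith⟩, hxz, by linarith, by linarith⟩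
  · push Not at hex
    -- Points of the state space are at least `c` apart, so the ball contains only the start `0`,
    -- and increments in `[-M, -c]` land in that interval itself.
    refine ⟨0, zero_mem _, Metric.ball 0 c, Metric.isOpen_ball, Metric.mem_ball_self hc, _,
      hK (-M) (-c), hKE (by linarith), _, hM, fun x hx hxZ =>
        measure_le_jumpOp measurableSet_Icc hxZ fun z hz hxz => ?_⟩
    obtain rfl : x = 0 := eq_of_mem_stateSpace_of_dist_lt hex hxZ (zero_mem _) hx
    rw [zero_add] at hxz ⊢
    exact ⟨⟨le_rfl, by dsimp only; linarith [hz.2]⟩, hxz, hz⟩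

end UniformJump

end RandomWalk

/-! ### The three overshoot chains -/

theorem corollary5p2 (μ : Measure ℝ) [IsProbabilityMeasure μ]
    (hnondeg : ∀ c : ℝ, μ ≠ Measure.dirac c)
    (hrec : RandomWalk.TopologicallyRecurrent μ)
    (lam : Measure (RandomWalk.stateSpace μ)) [lam.IsAddHaarMeasure] :
    (MarkovChain.IsRecurrent (RandomWalk.upOvershootChain μ)
        ((RandomWalk.stateSpace μ : Set ℝ) ∩ Set.Ici 0) (RandomWalk.piPlus μ lam) ∧
      MarkovChain.IsErgodic (RandomWalk.upOvershootChain μ)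
        ((RandomWalk.stateSpace μ : Set ℝ) ∩ Set.Ici 0) (RandomWalk.piPlus μ lam) ∧
      MarkovChain.IsUniquelyInvariant (RandomWalk.upOvershootChain μ)
        ((RandomWalk.stateSpace μ : Set ℝ) ∩ Set.Ici 0) (RandomWalk.piPlus μ lam)) ∧
    (MarkovChain.IsRecurrent (RandomWalk.downOvershootChain μ)
        ((RandomWalk.stateSpace μ : Set ℝ) ∩ Set.Iio 0) (RandomWalk.piMinus μ lam) ∧
      MarkovChain.IsErgodic (RandomWalk.downOvershootChain μ)
        ((RandomWalk.stateSpace μ : Set ℝ) ∩ Set.Iio 0) (RandomWalk.piMinus μ lam) ∧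
      MarkovChain.IsUniquelyInvariant (RandomWalk.downOvershootChain μ)
        ((RandomWalk.stateSpace μ : Set ℝ) ∩ Set.Iio 0) (RandomWalk.piMinus μ lam)) ∧
    (MarkovChain.IsRecurrent (RandomWalk.overshootChain μ)
        (RandomWalk.stateSpace μ : Set ℝ) (RandomWalk.piFull μ lam) ∧
      MarkovChain.IsErgodic (RandomWalk.overshootChain μ)
        (RandomWalk.stateSpace μ : Set ℝ) (RandomWalk.piFull μ lam) ∧
      MarkovChain.IsUniquelyInvariant (RandomWalk.overshootChain μ)
        (RandomWalk.stateSpace μ : Set ℝ) (RandomWalk.piFull μ lam)) := by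
  have hnd := hnondeg 0
  have hup := RandomWalk.hasUniformJump_upJumps (RandomWalk.measure_Ioi_zero_pos hrec hnd)
  have hdown := RandomWalk.hasUniformJump_downJumps (RandomWalk.measure_Iio_zero_pos hrec hnd)
  have hUp := RandomWalk.measurableSet_upJumps
  have hDown := RandomWalk.measurableSet_downJumps
  have hcup (x : ℝ) (hx : x ∈ RandomWalk.stateSpace μ) :=
    RandomWalk.ae_exists_upJump hrec hnd hx
  have hcdown (x : ℝ) (hx : x ∈ RandomWalk.stateSpace μ) :=
    RandomWalk.ae_exists_downJump hrec hnd hx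
  have hupA : ∀ p ∈ RandomWalk.upJumps, p.2 ∈ Set.Ici (0 : ℝ) := fun p hp => hp.2
  have hdownA : ∀ p ∈ RandomWalk.downJumps, p.2 ∈ Set.Iio (0 : ℝ) := fun p hp => hp.2
  have hJup := RandomWalk.listsJumps_upOvershoot
  have hJdown := RandomWalk.listsJumps_downOvershoot
  have hJ := RandomWalk.listsJumps_overshoot
  -- The three measures are the entrance measures `λ P_C` of the walk, so the general theorems
  -- apply.
  rw [← RandomWalk.jump_upJumps_onReal lam, ← RandomWalk.jump_downJumps_onReal lam,
    ← RandomWalk.jump_union_onReal lam]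
  refine ⟨⟨?_, ?_, ?_⟩, ⟨?_, ?_, ?_⟩, ?_⟩
  · exact RandomWalk.isRecurrent_jump_onReal hrec hJup hUp measurableSet_Ici hupA hcup
  · exact RandomWalk.isErgodic_jump_onReal hrec hJup hUp measurableSet_Ici hupA hcup
  · exact RandomWalk.isUniquelyInvariant_jump_onReal hrec hJup hUp measurableSet_Ici hupA hcup hup
  · exact RandomWalk.isRecurrent_jump_onReal hrec hJdown hDown measurableSet_Iio hdownA hcdown
  · exact RandomWalk.isErgodic_jump_onReal hrec hJdown hDown measurableSet_Iio hdownA hcdown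
  · exact RandomWalk.isUniquelyInvariant_jump_onReal hrec hJdown hDown measurableSet_Iio hdownA
      hcdown hdown
  · have hC := hUp.union hDown
    have hA : ∀ p ∈ RandomWalk.upJumps ∪ RandomWalk.downJumps, p.2 ∈ (Set.univ : Set ℝ) :=
      fun _ _ => Set.mem_univ _
    have hc (x : ℝ) (hx : x ∈ RandomWalk.stateSpace μ) :
        ∀ᵐ s ∂(RandomWalk.walkLaw μ x),
          ∃ n, (s n, s (n + 1)) ∈ RandomWalk.upJumps ∪ RandomWalk.downJumps := by
      filter_upwards [hcup x hx] with s hs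
      exact hs.imp fun n hn => Or.inl hn
    have hunif : RandomWalk.HasUniformJump μ (RandomWalk.upJumps ∪ RandomWalk.downJumps)
        ((RandomWalk.stateSpace μ : Set ℝ) ∩ Set.univ) :=
      hup.mono Set.subset_union_left (Set.inter_subset_inter_right _ (Set.subset_univ _))
    -- The chain of all overshoots has no sign constraint; it is the case `A = univ`.
    rw [← Set.inter_univ (RandomWalk.stateSpace μ : Set ℝ)]
    exact ⟨RandomWalk.isRecurrent_jump_onReal hrec hJ hC MeasurableSet.univ hA hc,
      RandomWalk.isErgodic_jump_onReal hrec hJ hC MeasurableSet.univ hA hc,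
      RandomWalk.isUniquelyInvariant_jump_onReal hrec hJ hC MeasurableSet.univ hA hc hunif⟩
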